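/- **Setting.** Let $X$ be a finite non-empty data universe and $n\ge 1$. A database is $D=(x^{(1)},\dots,x^{(n)})\in X^n$. A linear query is a function $q:X\to[0,1]$, with $q(D)=\frac1n\sum_i q(x^{(i)})$ and negation $\neg q=1-q$. Analysts $1,\dots,m$ submit finite query sets $Q_1,\dots,Q_m$, not all empty, and $Q=\bigcup_j (Q_j\cup\neg Q_j)$. Let $G_D(x,q)=\frac{1+q(D)-q(x)}{2}$. For a positive function $A$ on a finite set, $\tilde A=A/|A|$ with $|A|=\sum_a A(a)$, and $\Gamma_sA$ is the function $a\mapsto\min\{1,cA(a)\}$ with $c\ge1$ chosen so that its sum is $s$ ($\Gamma_sA\equiv1$ if $A$ lives on fewer than $s$ points). Logarithms are natural. **The offline mechanism** (parameters $\varepsilon,\delta,\beta$). Put $M=\max\{\log|X|,\log|Q|\}$, let $T$ be the least positive integer with $T\ge nM$, and put $\eta=\frac{\varepsilon}{2\sqrt{T\log(1/\delta)}}$ and $s=12T$. Start with $D_0\equiv 1/|X|$ on $X$ and $Q_1\equiv 1/|Q|$ on $Q$. For $t=1,\dots,T$: * sample $\hat q_t\sim\tilde P_t$, where $P_t=\Gamma_sQ_t$;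 * set $D_t(x)=D_{t-1}(x)\,e^{-\eta\, G_D(x,\hat q_t)}$ for all $x\in X$ and sample $\hat x_t\sim\tilde D_t$; * set $Q_{t+1}(q)=Q_t(q)\,e^{-\eta\,(1-G_D(\hat x_t,q))}$ for all $q\in Q$. Let $\hat D=(\hat x_1,\dots,\hat x_T)$ and $q(\hat D)=\frac1T\sum_t q(\hat x_t)$. Write $\lambda_k=\frac{1}{n}\cdot\frac{\sqrt{8k\log(3/\delta)}}{\varepsilon/3}$. *Sparse vector.* Let $\kappa>0$ be a fixed constant, and let $b=\kappa\lambda_s$, $\rho=\eta+\frac{M}{\eta T}+\frac{4\log(6/\beta)}{\sqrt T}$ and $\theta=4\rho+b\log(3|Q|/\beta)$. Scan the queries $q\in Q$ in a fixed order, and let $Q_f$ consist of the first (at most $s$) queries with $q(D)-q(\hat D)+\mathrm{Lap}(b)\ge\theta$, using fresh independent noise for each query. *Laplace mechanism.* For each $q\in Q_f$ let $a_q=q(D)+\mathrm{Lap}(\lambda_{|Q_f|})$, with independent noise. *Output.* Every analyst $j$ receives $\hat D$ and the pairs $(q,a_q)$ with $q\in Q_f\cap(Q_j\cup\neg Q_j)$.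 From its output, analyst $j$ evaluates a query $q\in Q_j\cup\neg Q_j$ as $a_q$ if $q\in Q_f$, as $1-a_{\neg q}$ if $q\notin Q_f$ and $\neg q\in Q_f$, and as $q(\hat D)$ otherwise. **Theorem.** For all $\kappa>0$ and $\delta_0<1$ there is a constant $C>0$, depending only on $\kappa$ and $\delta_0$, such that for all $X,n,m,Q_1,\dots,Q_m$ as above and all $0<\varepsilon\le1$, $0<\delta\le\delta_0$, $0<\beta\le1$, the offline mechanism is $(\alpha,\beta)$-accurate for $$\alpha=C\cdot\frac{\sqrt{\log(|X|+|Q|)\,\log(1/\delta)}\;\log(|Q|/\beta)}{\varepsilon\sqrt n}.$$ That is, for every database $D\in X^n$, with probability at least $1-\beta$ over the coins of the mechanism, for every $j$ and every $q\in Q_j\cup\neg Q_j$ the value that analyst $j$ evaluates for $q$ differs from $q(D)$ by at most $\alpha$. -/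

import Mathlib

open MeasureTheory
open scoped ENNReal

universe u

noncomputable section

namespace OfflineMech

/-! ### Databases and linear queries -/

/-- A linear query over the data universe `X` is a function `X → [0,1]`. -/
abbrev Query (X : Type*) := X → unitInterval

/-- The negated query `¬q = 1 - q`. -/
def negate {X : Type*} (q : Query X) : Query X := fun x => unitInterval.symm (q x)

/-- The value `q(D) = (1/n) ∑ᵢ q(x⁽ⁱ⁾)` on a database of `n` rows. -/
def onDatabase {X : Type*} {n : ℕ} (q : Query X) (D : Fin n → X) : ℝ :=
  (∑ i, (q (D i) : ℝ)) / n

/-- The value of `q` on a synthetic database, given as the list of its rows. -/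
def onSynthetic {X : Type*} (q : Query X) (S : List X) : ℝ :=
  (S.map fun x => (q x : ℝ)).sum / S.length

open Classical in
/-- `𝒬ⱼ ∪ ¬𝒬ⱼ`. -/
def withNegations {X : Type*} (S : Finset (Query X)) : Finset (Query X) :=
  S ∪ S.image negate

open Classical in
/-- `𝒬 = ⋃ⱼ (𝒬ⱼ ∪ ¬𝒬ⱼ)`. -/
def allQueries {X : Type*} {m : ℕ} (Qs : Fin m → Finset (Query X)) : Finset (Query X) :=
  Finset.univ.biUnion fun j => withNegations (Qs j)

/-! ### Accuracy of a many-analyst mechanism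

A randomized mechanism is given by the law `coins D` of its random choices on input `D` and by
its output `A D ω j` to analyst `j` when the random choices are `ω`. -/

/-- `(α, β)`-accuracy: for every database, with probability at least `1 - β` every query of every
analyst, as evaluated from the output to that analyst, is answered within `α`. -/
def IsAccurate {X Ω R : Type*} [MeasurableSpace Ω] {n m : ℕ}
    (coins : (Fin n → X) → Measure Ω) (A : (Fin n → X) → Ω → Fin m → R)
    (eval : R → Query X → ℝ) (Qs : Fin m → Finset (Query X)) (α β : ℝ) : Prop :=
  ∀ D : Fin n → X, ENNReal.ofReal (1 - β) ≤
    coins D {ω | ∀ j, ∀ q ∈ Qs j, |eval (A D ω j) q - onDatabase q D| ≤ α}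

/-! ### Measures over actions, sampling, projection -/

/-- The distribution `a ↦ A(a) / |A|` of a (full-support) measure `A` over a finite set of
actions. -/
def sample {𝒜 : Type*} [Fintype 𝒜] [Nonempty 𝒜] (A : 𝒜 → ℝ) (hA : ∀ a, 0 < A a) : PMF 𝒜 :=
  PMF.normalize (fun a => ENNReal.ofReal (A a))
    (by
      obtain ⟨a⟩ := ‹Nonempty 𝒜›
      rw [Ne, ENNReal.tsum_eq_zero]
      intro h
      exact absurd (h a) (by simpa using hA a))
    (by
      rw [tsum_fintype]
      exact ENNReal.sum_ne_top.2 fun _ _ => ENNReal.ofReal_ne_top)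

open Classical in
/-- The Bregman projection `Γ_s A` into the set of density-`s` measures: `a ↦ min {1, c A(a)}`
where `c ≥ 1` is such that the total mass is `s`. There is no measure `𝒜 → [0,1]` of density `s`
if `s > |𝒜|`; the projection is then the measure of maximal density, which is constantly `1`. -/
def proj {𝒜 : Type*} [Fintype 𝒜] (s : ℝ) (A : 𝒜 → ℝ) : 𝒜 → ℝ :=
  if h : ∃ c : ℝ, 1 ≤ c ∧ ∑ a, min 1 (c * A a) = s then
    fun a => min 1 (h.choose * A a)
  else fun _ => 1

lemma proj_pos {𝒜 : Type*} [Fintype 𝒜] (s : ℝ) {A : 𝒜 → ℝ} (hA : ∀ a, 0 < A a) (a : 𝒜) :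
    0 < proj s A a := by
  unfold proj
  split_ifs with h
  · exact lt_min one_pos (mul_pos (lt_of_lt_of_le one_pos h.choose_spec.1) (hA a))
  · exact one_pos

/-! ### The two players -/

section Players

variable {X : Type u} {n : ℕ}

/-- The payoff `G_D(x, q) = (1 + q(D) - q(x)) / 2`. The data player wants it small and the query
player wants it large. -/
def payoff (D : Fin n → X) (x : X) (q : Query X) : ℝ := (1 + onDatabase q D - q x) / 2

/-- The data player's measure `D_t` after the queries `q̂₁, …, q̂_t` (most recent first):
multiplicative weights with losses `x ↦ G_D(x, q̂_t)`. -/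
def dataMeasure [Fintype X] (η : ℝ) (D : Fin n → X) : List (Query X) → X → ℝ
  | [], _ => 1 / Fintype.card X
  | q :: qs, x => dataMeasure η D qs x * Real.exp (-η * payoff D x q)

/-- The query player's measure after the records `x̂₁, …, x̂_t` (most recent first): multiplicative
weights with losses `q ↦ 1 - G_D(x̂_t, q)`. -/
def queryMeasure (η : ℝ) (D : Fin n → X) (Q : Finset (Query X)) : List X → Q → ℝ
  | [], _ => 1 / Q.card
  | x :: xs, q => queryMeasure η D Q xs q * Real.exp (-η * (1 - payoff D x q))

lemma dataMeasure_pos [Fintype X] [Nonempty X] (η : ℝ) (D : Fin n → X) (qs : List (Query X)) (x : X) :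
    0 < dataMeasure η D qs x := by
  induction qs with
  | nil =>
    have : 0 < Fintype.card X := Fintype.card_pos
    simp only [dataMeasure]
    positivity
  | cons q qs ih => exact mul_pos ih (Real.exp_pos _)

lemma queryMeasure_pos (η : ℝ) (D : Fin n → X) (Q : Finset (Query X)) (xs : List X) (q : Q) :
    0 < queryMeasure η D Q xs q := by
  induction xs with
  | nil =>
    have : 0 < Q.card := Finset.card_pos.2 ⟨q, q.2⟩
    simp only [queryMeasure]
    positivity
  | cons x xs ih => exact mul_pos ih (Real.exp_pos _)

/-- The actions played so far, most recent first. -/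
structure Transcript (X : Type u) (Q : Finset (Query X)) where
  queries : List Q
  records : List X

instance (X : Type u) (Q : Finset (Query X)) : MeasurableSpace (Transcript X Q) := ⊤

/-- The law of the play after `t` rounds. In each round the query player samples `q̂` from the
projection of its current measure, the data player updates its measure with `q̂` and samples `x̂`,
and the query player updates its measure with `x̂`. -/
def play [Fintype X] [Nonempty X] (s η : ℝ) (D : Fin n → X) (Q : Finset (Query X))
    (hQ : Q.Nonempty) : ℕ → PMF (Transcript X Q)
  | 0 => PMF.pure ⟨[], []⟩
  | t + 1 =>
    haveI : Nonempty Q := hQ.to_subtype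
    (play s η D Q hQ t).bind fun h =>
      (sample (proj s (queryMeasure η D Q h.records))
        (proj_pos s (queryMeasure_pos η D Q h.records))).bind fun q =>
      (sample (dataMeasure η D ((q :: h.queries).map Subtype.val))
        (dataMeasure_pos η D _)).bind fun x =>
      PMF.pure ⟨q :: h.queries, x :: h.records⟩

end Players

/-! ### Laplace noise, sparse vector, Laplace mechanism -/

/-- The standard Laplace distribution, with density `exp (-|z|) / 2`; `Lap(b)` is the law of `b z`
for a standard Laplace variable `z`. -/
def laplace : Measure ℝ := volume.withDensity fun z => ENNReal.ofReal (Real.exp (-|z|) / 2)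

/-- The noise scale `ε⁻¹ Δ √(8 k log(1/δ))` for `k` answers of sensitivity `Δ`. -/
def noiseScale (ε δ Δ : ℝ) (k : ℕ) : ℝ := Δ * √(8 * k * Real.log (1 / δ)) / ε

open Classical in
/-- Sparse vector on the values `f i`: the indices are scanned in a fixed order, the noisy value
`f i + Lap(b)` (with fresh noise) is compared to the threshold `θ`, and the first `k` indices that
pass are returned. -/
def sparseVector {ι : Type*} [Fintype ι] (f : ι → ℝ) (θ b : ℝ) (k : ℕ) (z : ι → ℝ) : Finset ι :=
  (((Finset.univ : Finset ι).toList.filter fun i => θ ≤ f i + b * z i).take k).toFinset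

/-! ### The mechanism -/

/-- What one analyst receives: the rows of the synthetic database, and the answers `a_q` for those
queries `q` for which the pair `(q, a_q)` is released to this analyst. -/
structure Output (X : Type u) where
  synthetic : List X
  answers : Query X → Option ℝ

/-- The evaluator: a released answer to `q` (or, failing that, to `¬q`) is used if there is one, and
the synthetic database otherwise. -/
def evaluate {X : Type u} (Z : Output X) (q : Query X) : ℝ :=
  match Z.answers q, Z.answers (negate q) with
  | some a, _ => a
  | none, some a => 1 - a
  | none, none => onSynthetic q Z.synthetic

section Mechanism

variable {X : Type u} [Fintype X] [Nonempty X] {n m : ℕ}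

/-- `max {log |X|, log |Q|}`. -/
def logSize (Q : Finset (Query X)) : ℝ := max (Real.log (Fintype.card X)) (Real.log Q.card)

/-- The number of rounds `T = n · max {log |X|, log |Q|}`, rounded up to a positive integer. -/
def rounds (n : ℕ) (Q : Finset (Query X)) : ℕ := max 1 ⌈(n : ℝ) * logSize Q⌉₊

/-- The learning rate `η = ε / (2 √(T log(1/δ)))`. -/
def learningRate (n : ℕ) (Q : Finset (Query X)) (ε δ : ℝ) : ℝ :=
  ε / (2 * √(rounds n Q * Real.log (1 / δ)))

/-- The density `s = 12 T`. -/
def density (n : ℕ) (Q : Finset (Query X)) : ℕ := 12 * rounds n Q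

/-- The error `4ρ`, `ρ = η + max {log |X|, log |Q|} / (η T) + 4 log(2/β') / √T`. -/
def equilibriumError (n : ℕ) (Q : Finset (Query X)) (ε δ β' : ℝ) : ℝ :=
  4 * (learningRate n Q ε δ + logSize Q / (learningRate n Q ε δ * rounds n Q)
    + 4 * Real.log (2 / β') / √(rounds n Q))

/-- The scale of the noise in sparse vector, run with privacy parameters `(ε/3, δ/3)`; `κ` is the
absolute constant in this scale. -/
def svScale (κ : ℝ) (n : ℕ) (Q : Finset (Query X)) (ε δ : ℝ) : ℝ :=
  κ * noiseScale (ε / 3) (δ / 3) (1 / n) (density n Q)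

/-- The threshold of sparse vector, run with failure probability `β/3`. -/
def svThreshold (κ : ℝ) (n : ℕ) (Q : Finset (Query X)) (ε δ β : ℝ) : ℝ :=
  equilibriumError n Q ε δ (β / 3) + svScale κ n Q ε δ * Real.log (Q.card / (β / 3))

/-- The random choices: the play, and standard Laplace variables for sparse vector and for the
Laplace mechanism. -/
abbrev Coins (X : Type u) (Q : Finset (Query X)) := Transcript X Q × (Q → ℝ) × (Q → ℝ)

/-- The law of the random choices on input `D`. -/
def coinLaw (Q : Finset (Query X)) (hQ : Q.Nonempty) (ε δ : ℝ) (D : Fin n → X) :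
    Measure (Coins X Q) :=
  (play (density n Q) (learningRate n Q ε δ) D Q hQ (rounds n Q)).toMeasure.prod
    ((Measure.pi fun _ => laplace).prod (Measure.pi fun _ => laplace))

/-- The synthetic database `(x̂₁, …, x̂_T)`. -/
def synthetic {Q : Finset (Query X)} (ω : Coins X Q) : List X := ω.1.records.reverse

/-- The set `Q_f` of at most `s` queries found by sparse vector on the errors
`q(D) - q(D̂)`, `q ∈ Q`. As `Q` is closed under negation, errors of both signs are covered. -/
def flagged (κ : ℝ) (Q : Finset (Query X)) (ε δ β : ℝ) (D : Fin n → X) (ω : Coins X Q) :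
    Finset Q :=
  sparseVector (fun q : Q => onDatabase q.1 D - onSynthetic q.1 (synthetic ω))
    (svThreshold κ n Q ε δ β) (svScale κ n Q ε δ) (density n Q) ω.2.1

/-- The Laplace mechanism's answer to `q`, run on `Q_f` with privacy parameters `(ε/3, δ/3)`. -/
def laplaceAnswer (κ : ℝ) (Q : Finset (Query X)) (ε δ β : ℝ) (D : Fin n → X) (ω : Coins X Q)
    (q : Q) : ℝ :=
  onDatabase q.1 D
    + noiseScale (ε / 3) (δ / 3) (1 / n) (flagged κ Q ε δ β D ω).card * ω.2.2 q

open Classical in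
/-- The offline mechanism for linear queries: every analyst gets the synthetic database, and the
pairs `(q, a_q)`, `q ∈ Q_f`, for the (possibly negated) queries it issued. -/
def mechanism (κ : ℝ) (Qs : Fin m → Finset (Query X)) (ε δ β : ℝ) (D : Fin n → X)
    (ω : Coins X (allQueries Qs)) (j : Fin m) : Output X where
  synthetic := synthetic ω
  answers q :=
    if h : q ∈ allQueries Qs then
      if q ∈ withNegations (Qs j) ∧ ⟨q, h⟩ ∈ flagged κ (allQueries Qs) ε δ β D ω then
        some (laplaceAnswer κ (allQueries Qs) ε δ β D ω ⟨q, h⟩)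
      else none
    else none

end Mechanism

end OfflineMech

end

noncomputable section

namespace OfflineMech

/-! ### Relative entropy and the projection -/

/-! The mechanism plays a zero-sum game by multiplicative weights, and the synthetic database is the
list of the data player's moves. The proof shows that at most `s` queries of `Q` have error above
the equilibrium error `4ρ`; sparse vector then finds all queries with a much larger error, and these
get direct noisy answers.

Data player: the uniform distribution on the rows of `D` has payoff exactly 1/2 against every query.
The data player updates with the query before replying to it, so its regret has no second-order term
and its total payoff is at most `T/2 + M/η` (`dataPlayer_regret`). Query player: a relative entropy
argument with the projection bounds the regret by `M/η + Tη/2` against the uniform distribution on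
any `s` queries (`queryPlayer_regret`). If more than `s` queries were bad, `s` of them would have
average total payoff above `T(1 + 4ρ)/2`, so the query player's mixed payoffs would exceed those of
the data player by more than `gapBound` (`card_badQueries_le`).

Such a gap is unlikely. Given the past, the gap of one round would have mean zero if the record were
drawn before the data player's update, and the update shifts the mean by at most `e^η - 1`. An
exponential moment bound (`round_moment`, `play_moment`) and Markov's inequality give the tail
(`play_tail`).

When all Laplace variables are below `L = log(3|Q|/β)` in absolute value, only bad queries pass the
threshold, so sparse vector is never cut off, and unflagged queries have error at most `4ρ + 2bL`
(`evaluate_error`). It remains to compare the parameters with `α` (`error_le`). A single query needs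
separate care, since then `α` can be 0. -/

lemma sub_le_mul_log_div {x y : ℝ} (hx : 0 ≤ x) (hy : 0 < y) : x - y ≤ x * Real.log (x / y) := by
  rcases hx.eq_or_lt with rfl | hx
  · simp [hy.le]
  · have h := Real.log_le_sub_one_of_pos (div_pos hy hx)
    have h2 : Real.log (x / y) = -Real.log (y / x) := by rw [← Real.log_inv, inv_div]
    have h3 : x * (y / x - 1) = y - x := by field_simp
    rw [h2]
    nlinarith [mul_le_mul_of_nonneg_left h hx.le]

section Projection

variable {𝒜 : Type*} [Fintype 𝒜]

lemma exists_scale {s : ℝ} {A : 𝒜 → ℝ} (hA : ∀ a, 0 < A a) (hA1 : ∑ a, A a ≤ s)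
    (hs : s ≤ Fintype.card 𝒜) : ∃ c : ℝ, 1 ≤ c ∧ ∑ a, min 1 (c * A a) = s := by
  -- At this scale every value is clipped to 1, so the mass is the full cardinality; at scale 1 it
  -- is at most `s`. The intermediate value theorem does the rest.
  set C : ℝ := 1 + ∑ a, (A a)⁻¹ with hC
  have hinv : ∀ a, 0 < (A a)⁻¹ := fun a => inv_pos.2 (hA a)
  have hC1 : (1 : ℝ) ≤ C := by
    have := Finset.sum_nonneg fun a (_ : a ∈ Finset.univ) => (hinv a).le
    linarith
  have hcont : Continuous fun c : ℝ => ∑ a, min 1 (c * A a) := by fun_prop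
  have hlow : ∑ a, min 1 (1 * A a) ≤ s :=
    (Finset.sum_le_sum fun a _ => (min_le_right _ _).trans (one_mul _).le).trans hA1
  have hhigh : ∑ a, min 1 (C * A a) = Fintype.card 𝒜 := by
    rw [Finset.sum_congr rfl (g := fun _ => (1 : ℝ)), Finset.sum_const, Finset.card_univ,
      nsmul_eq_mul, mul_one]
    intro a _
    apply min_eq_left
    have h1 : (A a)⁻¹ ≤ C := by
      have := Finset.single_le_sum (fun a _ => (hinv a).le) (Finset.mem_univ a)
      linarith
    calc (1 : ℝ) = (A a)⁻¹ * A a := (inv_mul_cancel₀ (hA a).ne').symm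
      _ ≤ C * A a := mul_le_mul_of_nonneg_right h1 (hA a).le
  obtain ⟨c, hc, hcs⟩ := intermediate_value_Icc hC1 hcont.continuousOn
    (show s ∈ Set.Icc _ _ from ⟨hlow, hs.trans hhigh.ge⟩)
  exact ⟨c, hc.1, hcs⟩

lemma proj_spec {s : ℝ} {A : 𝒜 → ℝ} (hA : ∀ a, 0 < A a) (hA1 : ∑ a, A a ≤ s)
    (hs : s ≤ Fintype.card 𝒜) :
    ∑ a, proj s A a = s ∧ ∃ c : ℝ, 1 ≤ c ∧ ∀ a, proj s A a = min 1 (c * A a) := by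
  have h := exists_scale hA hA1 hs
  have hp : proj s A = fun a => min 1 (h.choose * A a) := by
    unfold proj
    rw [dif_pos h]
  rw [hp]
  exact ⟨h.choose_spec.2, h.choose, h.choose_spec.1, fun _ => rfl⟩

/-- The generalized Pythagorean inequality for the Bregman projection. -/
lemma proj_pythagoras {s : ℝ} {A : 𝒜 → ℝ} (hA : ∀ a, 0 < A a) (hA1 : ∑ a, A a ≤ s)
    (hs : s ≤ Fintype.card 𝒜) {p : 𝒜 → ℝ} (hp1 : ∀ a, p a ≤ 1) (hps : ∑ a, p a = s) :
    ∑ a, proj s A a * Real.log (proj s A a / A a) ≤ ∑ a, p a * Real.log (proj s A a / A a) := by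
  obtain ⟨hsum, c, hc, hpr⟩ := proj_spec hA hA1 hs
  -- Both measures have mass `s`, so subtracting the constant `log c` changes nothing. The log ratio
  -- equals `log c` where the projection is not clipped; where it is clipped, the ratio is at most
  -- `log c` and `p a ≤ 1 = P a`.
  have key : ∀ a, 0 ≤ (p a - proj s A a) * (Real.log (proj s A a / A a) - Real.log c) := by
    intro a
    have hc0 : 0 < c := by linarith
    rcases le_total 1 (c * A a) with h | h
    · rw [hpr, min_eq_left h]
      have h1 : Real.log (1 / A a) ≤ Real.log c := by
        apply Real.log_le_log (by have := hA a; positivity)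
        rw [div_le_iff₀ (hA a)]
        exact h
      exact mul_nonneg_of_nonpos_of_nonpos (by linarith [hp1 a]) (by linarith)
    · rw [hpr, min_eq_right h, mul_div_cancel_right₀ _ (hA a).ne']
      simp
  have h2 := Finset.sum_nonneg fun a (_ : a ∈ Finset.univ) => key a
  have h3 : ∑ a, (p a - proj s A a) * (Real.log (proj s A a / A a) - Real.log c)
      = (∑ a, p a * Real.log (proj s A a / A a)
        - ∑ a, proj s A a * Real.log (proj s A a / A a))
        - ((∑ a, p a) - ∑ a, proj s A a) * Real.log c := by
    rw [← Finset.sum_sub_distrib, ← Finset.sum_sub_distrib, Finset.sum_mul,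
      ← Finset.sum_sub_distrib]
    exact Finset.sum_congr rfl fun a _ => by ring
  rw [h3, hps, hsum, sub_self, zero_mul, sub_zero] at h2
  linarith

/-- The effect of one multiplicative update on the relative entropy. -/
lemma entropy_step {s η : ℝ} (hη : 0 ≤ η) {A ℓ : 𝒜 → ℝ} (hA : ∀ a, 0 < A a)
    (hA1 : ∑ a, A a ≤ s) (hs : s ≤ Fintype.card 𝒜) (hℓ0 : ∀ a, 0 ≤ ℓ a) (hℓ1 : ∀ a, ℓ a ≤ 1)
    {p : 𝒜 → ℝ} (hp0 : ∀ a, 0 ≤ p a) (hp1 : ∀ a, p a ≤ 1) (hps : ∑ a, p a = s) :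
    ∑ a, proj s A a * Real.log (proj s A a / A a) + (η * ∑ a, proj s A a * ℓ a - s * (η ^ 2 / 2))
      ≤ ∑ a, p a * Real.log (p a / (A a * Real.exp (-η * ℓ a))) := by
  have hP := proj_pythagoras hA hA1 hs hp1 hps
  have hPs := (proj_spec hA hA1 hs).1
  set P := proj s A with hPdef
  have hPpos : ∀ a, 0 < P a := proj_pos s hA
  -- Divide by `P e^{-ηℓ}` in place of `A e^{-ηℓ}`, then use `p log(p/y) ≥ p - y`. After summation
  -- `∑ p` and `∑ P` cancel, both being `s`.
  have key : ∀ a, p a * Real.log (P a / A a) + (p a - P a + η * (P a * ℓ a) - P a * (η ^ 2 / 2))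
      ≤ p a * Real.log (p a / (A a * Real.exp (-η * ℓ a))) := by
    intro a
    have h1 := sub_le_mul_log_div (hp0 a) (mul_pos (hPpos a) (Real.exp_pos (-η * ℓ a)))
    have h2 : p a * Real.log (p a / (A a * Real.exp (-η * ℓ a)))
        = p a * Real.log (P a / A a) + p a * Real.log (p a / (P a * Real.exp (-η * ℓ a))) := by
      rcases (hp0 a).eq_or_lt with h | h
      · simp [← h]
      · rw [← mul_add, ← Real.log_mul (div_pos (hPpos a) (hA a)).ne'
          (div_pos h (mul_pos (hPpos a) (Real.exp_pos _))).ne']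
        congr 2
        have := (hPpos a).ne'
        have := (hA a).ne'
        field_simp
    have h3 : Real.exp (-η * ℓ a) ≤ 1 - η * ℓ a + η ^ 2 / 2 := by
      have hx : 0 ≤ η * ℓ a := mul_nonneg hη (hℓ0 a)
      have h4 := Real.quadratic_le_exp_of_nonneg hx
      have h5 : Real.exp (-η * ℓ a) = (Real.exp (η * ℓ a))⁻¹ := by
        rw [neg_mul, Real.exp_neg]
      have h6 : (η * ℓ a) ^ 2 ≤ η ^ 2 := by
        rw [mul_pow]
        have : ℓ a ^ 2 ≤ 1 := by nlinarith [hℓ0 a, hℓ1 a]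
        nlinarith [sq_nonneg η]
      have h7 : Real.exp (-η * ℓ a) ≤ 1 - η * ℓ a + (η * ℓ a) ^ 2 / 2 := by
        -- The upper bound for `e^{-x}` follows from `e^x ≥ 1 + x + x²/2`, because `(1 - x + x²/2)(1
        -- + x + x²/2) = 1 + x⁴/4`.
        rw [h5, inv_le_iff_one_le_mul₀ (Real.exp_pos _)]
        generalize η * ℓ a = x at *
        have h8 : 0 < 1 - x + x ^ 2 / 2 := by nlinarith [sq_nonneg (x - 1)]
        calc (1 : ℝ) ≤ (1 - x + x ^ 2 / 2) * (1 + x + x ^ 2 / 2) := by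
              nlinarith [sq_nonneg (x ^ 2)]
          _ ≤ _ := mul_le_mul_of_nonneg_left h4 h8.le
      linarith
    have h4 := mul_le_mul_of_nonneg_left h3 (hPpos a).le
    rw [h2]
    linarith
  have h5 := Finset.sum_le_sum fun a (_ : a ∈ Finset.univ) => key a
  rw [Finset.sum_add_distrib, Finset.sum_sub_distrib, Finset.sum_add_distrib,
    Finset.sum_sub_distrib, ← Finset.mul_sum, ← Finset.sum_mul, hps, hPs] at h5
  linarith

end Projection

/-! ### Queries and payoffs -/

section Payoff

variable {X : Type u} {n : ℕ}

lemma query_nonneg (q : Query X) (x : X) : 0 ≤ (q x : ℝ) := (q x).2.1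
lemma query_le_one (q : Query X) (x : X) : (q x : ℝ) ≤ 1 := (q x).2.2

lemma onDatabase_nonneg (q : Query X) (D : Fin n → X) : 0 ≤ onDatabase q D :=
  div_nonneg (Finset.sum_nonneg fun _ _ => query_nonneg q _) (Nat.cast_nonneg _)

lemma onDatabase_le_one (q : Query X) (D : Fin n → X) : onDatabase q D ≤ 1 := by
  refine div_le_one_of_le₀ ?_ (Nat.cast_nonneg _)
  refine (Finset.sum_le_sum fun i _ => query_le_one q (D i)).trans ?_
  simp

lemma payoff_nonneg (D : Fin n → X) (x : X) (q : Query X) : 0 ≤ payoff D x q := by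
  unfold payoff
  linarith [onDatabase_nonneg q D, query_le_one q x]

lemma payoff_le_one (D : Fin n → X) (x : X) (q : Query X) : payoff D x q ≤ 1 := by
  unfold payoff
  linarith [onDatabase_le_one q D, query_nonneg q x]

lemma sum_payoff_database (hn : 0 < n) (D : Fin n → X) (q : Query X) :
    ∑ i, payoff D (D i) q = n / 2 := by
  have hn' : (n : ℝ) ≠ 0 := by positivity
  unfold payoff
  rw [← Finset.sum_div, Finset.sum_sub_distrib, Finset.sum_const, Finset.card_univ,
    Fintype.card_fin, nsmul_eq_mul]
  have : ∑ i, (q (D i) : ℝ) = n * onDatabase q D := by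
    unfold onDatabase
    field_simp
  rw [this]
  ring

lemma sum_payoff_list (D : Fin n → X) (q : Query X) (xs : List X) :
    (xs.map fun x => payoff D x q).sum
      = xs.length * (1 + (onDatabase q D - onSynthetic q xs)) / 2 := by
  have h : ∀ ys : List X, (ys.map fun x => payoff D x q).sum
      = (ys.length * (1 + onDatabase q D) - (ys.map fun x => (q x : ℝ)).sum) / 2 := by
    intro ys
    induction ys with
    | nil => simp
    | cons y ys ih =>
      rw [List.map_cons, List.sum_cons, ih, List.map_cons, List.sum_cons, List.length_cons,
        payoff]
      push_cast
      ring
  rw [h]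
  unfold onSynthetic
  rcases xs with _ | ⟨x, xs⟩
  · simp
  · have : ((x :: xs).length : ℝ) ≠ 0 := by simp; positivity
    field_simp
    ring

lemma negate_negate (q : Query X) : negate (negate q) = q := by
  funext x
  simp [negate]

lemma onDatabase_negate (hn : 0 < n) (q : Query X) (D : Fin n → X) :
    onDatabase (negate q) D = 1 - onDatabase q D := by
  have hn' : (n : ℝ) ≠ 0 := by positivity
  simp only [onDatabase, negate, unitInterval.coe_symm_eq, Finset.sum_sub_distrib,
    Finset.sum_const, Finset.card_univ, Fintype.card_fin, nsmul_eq_mul, mul_one]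
  field_simp

lemma onSynthetic_negate {S : List X} (hS : S ≠ []) (q : Query X) :
    onSynthetic (negate q) S = 1 - onSynthetic q S := by
  have h : ∀ ys : List X, (ys.map fun x => (negate q x : ℝ)).sum
      = ys.length - (ys.map fun x => (q x : ℝ)).sum := by
    intro ys
    induction ys with
    | nil => simp
    | cons y ys ih =>
      rw [List.map_cons, List.sum_cons, ih, List.map_cons, List.sum_cons, List.length_cons,
        negate, unitInterval.coe_symm_eq]
      push_cast
      ring
  have hl : (S.length : ℝ) ≠ 0 := by
    simpa using hS
  unfold onSynthetic
  rw [h]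
  field_simp

lemma onSynthetic_reverse (q : Query X) (S : List X) :
    onSynthetic q S.reverse = onSynthetic q S := by
  simp [onSynthetic, List.sum_reverse]

lemma onSynthetic_nonneg (q : Query X) (S : List X) : 0 ≤ onSynthetic q S := by
  refine div_nonneg (List.sum_nonneg ?_) (Nat.cast_nonneg _)
  intro y hy
  obtain ⟨x, _, rfl⟩ := List.mem_map.1 hy
  exact query_nonneg q x

end Payoff

/-! ### Regret of the two players -/

section Regret

variable {X : Type u} {n : ℕ}

/-- The total payoff of the query player's mixed actions against the records `x̂₁, …, x̂_t`. -/
def queryPlayerPayoff (s η : ℝ) (D : Fin n → X) (Q : Finset (Query X)) : List X → ℝ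
  | [] => 0
  | x :: xs => queryPlayerPayoff s η D Q xs
      + (∑ q : Q, proj s (queryMeasure η D Q xs) q * payoff D x q) / s

/-- The total payoff of the data player's mixed actions against the queries `q̂₁, …, q̂_t`. -/
def dataPlayerPayoff [Fintype X] (η : ℝ) (D : Fin n → X) : List (Query X) → ℝ
  | [] => 0
  | q :: qs => dataPlayerPayoff η D qs
      + (∑ x, dataMeasure η D (q :: qs) x * payoff D x q) / ∑ x, dataMeasure η D (q :: qs) x

lemma queryMeasure_sum_le {η : ℝ} (hη : 0 ≤ η) (D : Fin n → X) (Q : Finset (Query X))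
    (xs : List X) : ∑ q, queryMeasure η D Q xs q ≤ 1 := by
  induction xs with
  | nil =>
    simp only [queryMeasure, Finset.sum_const, Finset.card_univ, Fintype.card_coe, nsmul_eq_mul]
    rw [mul_one_div]
    exact div_self_le_one _
  | cons x xs ih =>
    refine le_trans (Finset.sum_le_sum fun q _ => ?_) ih
    simp only [queryMeasure]
    refine mul_le_of_le_one_right (queryMeasure_pos η D Q xs q).le (Real.exp_le_one_iff.2 ?_)
    nlinarith [payoff_le_one D x q.1]

lemma log_queryMeasure (η : ℝ) (D : Fin n → X) (Q : Finset (Query X)) (xs : List X) (q : Q) :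
    Real.log (queryMeasure η D Q xs q)
      = -(Real.log Q.card + η * (xs.length - (xs.map fun x => payoff D x q).sum)) := by
  induction xs with
  | nil => simp [queryMeasure]
  | cons x xs ih =>
    rw [queryMeasure, Real.log_mul (queryMeasure_pos η D Q xs q).ne' (Real.exp_pos _).ne',
      Real.log_exp, ih]
    simp only [List.map_cons, List.sum_cons, List.length_cons]
    push_cast
    ring

/-- The potential is the least relative entropy of a density-`s` measure to the current weights,
attained at the projection. Each round raises it by at least `η` times the loss of the projection,
minus `sη²/2`. The bound is stated for all `p` because the inductive step applies it to the
projection itself. -/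
lemma queryMeasure_entropy {s η : ℝ} (hs1 : 1 ≤ s) (hη : 0 ≤ η) (D : Fin n → X)
    (Q : Finset (Query X)) (hsQ : s ≤ Q.card) (xs : List X) :
    ∀ p : Q → ℝ, (∀ a, 0 ≤ p a) → (∀ a, p a ≤ 1) → ∑ a, p a = s →
      s * Real.log s
        + s * (η * (xs.length - queryPlayerPayoff s η D Q xs) - xs.length * (η ^ 2 / 2))
        ≤ ∑ a, p a * Real.log (p a / queryMeasure η D Q xs a) := by
  have hs0 : 0 < s := by linarith
  have hcard : s ≤ Fintype.card Q := by simpa using hsQ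
  induction xs with
  | nil =>
    intro p hp0 _ hps
    have hQ0 : (0 : ℝ) < Q.card := by linarith
    -- Comparing with the uniform measure of mass `s` rather than with the initial weights of mass 1
    -- produces the term `s log s`.
    have key : ∀ a, p a - s / Q.card + p a * Real.log s
        ≤ p a * Real.log (p a / queryMeasure η D Q [] a) := by
      intro a
      have h1 := sub_le_mul_log_div (hp0 a) (div_pos hs0 hQ0)
      rcases (hp0 a).eq_or_lt with h | h
      · simp only [← h, zero_mul, zero_sub, add_zero]
        linarith [div_pos hs0 hQ0]
      · have h2 : p a / queryMeasure η D Q [] a = p a / (s / Q.card) * s := by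
          simp only [queryMeasure]
          field_simp
        rw [h2, Real.log_mul (by positivity) hs0.ne', mul_add]
        linarith
    have h3 := Finset.sum_le_sum fun a (_ : a ∈ Finset.univ) => key a
    rw [Finset.sum_add_distrib, Finset.sum_sub_distrib, ← Finset.sum_mul, hps, Finset.sum_const,
      Finset.card_univ, Fintype.card_coe, nsmul_eq_mul, mul_div_cancel₀ _ hQ0.ne'] at h3
    simp only [queryPlayerPayoff, List.length_nil]
    push_cast
    linarith
  | cons x xs ih =>
    intro p hp0 hp1 hps
    have hA := queryMeasure_pos η D Q xs
    have hA1 : ∑ q, queryMeasure η D Q xs q ≤ s := (queryMeasure_sum_le hη D Q xs).trans hs1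
    have hstep := entropy_step hη hA hA1 hcard (ℓ := fun q : Q => 1 - payoff D x q)
      (fun q => by linarith [payoff_le_one D x q.1]) (fun q => by linarith [payoff_nonneg D x q.1])
      hp0 hp1 hps
    obtain ⟨hPs, c, _, hPc⟩ := proj_spec hA hA1 hcard
    have hI := ih (proj s (queryMeasure η D Q xs)) (fun a => (proj_pos s hA a).le)
      (fun a => by rw [hPc]; exact min_le_left _ _) hPs
    have h1 : ∑ a, proj s (queryMeasure η D Q xs) a * (1 - payoff D x a)
        = s - s * ((∑ a, proj s (queryMeasure η D Q xs) a * payoff D x a) / s) := by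
      rw [mul_div_cancel₀ _ hs0.ne']
      simp only [mul_sub, mul_one, Finset.sum_sub_distrib, hPs]
    rw [h1] at hstep
    simp only [queryMeasure, queryPlayerPayoff, List.length_cons]
    push_cast
    refine le_trans ?_ hstep
    nlinarith [hI]

/-- Regret of the query player against the uniform distribution on `S`. -/
lemma queryPlayer_regret {s : ℕ} {η : ℝ} (hs1 : 1 ≤ s) (hη : 0 < η) (D : Fin n → X)
    (Q : Finset (Query X)) (S : Finset Q) (hS : S.card = s) (xs : List X) :
    (∑ q ∈ S, (xs.map fun x => payoff D x q).sum) / s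
      ≤ queryPlayerPayoff s η D Q xs + Real.log Q.card / η + xs.length * (η / 2) := by
  classical
  have hs1' : (1 : ℝ) ≤ s := by exact_mod_cast hs1
  have hs0 : (0 : ℝ) < s := by linarith
  have hsQ : (s : ℝ) ≤ Q.card := by
    have := Finset.card_le_univ S
    rw [Fintype.card_coe, hS] at this
    exact_mod_cast this
  have h := queryMeasure_entropy hs1' hη.le D Q hsQ xs (fun q => if q ∈ S then 1 else 0)
    (fun a => by split_ifs <;> simp) (fun a => by split_ifs <;> simp) (by rw [Finset.sum_ite_mem, Finset.univ_inter]; simp [hS])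
  simp only [ite_mul, one_mul, zero_mul, Finset.sum_ite_mem, Finset.univ_inter] at h
  have h2 : ∑ q ∈ S, Real.log ((if q ∈ S then 1 else 0) / queryMeasure η D Q xs q)
      = s * (Real.log Q.card + η * xs.length)
        - η * ∑ q ∈ S, (xs.map fun x => payoff D x q).sum := by
    rw [Finset.sum_congr rfl (g := fun q : Q => (Real.log Q.card + η * xs.length)
      - η * (xs.map fun x => payoff D x q).sum), Finset.sum_sub_distrib, Finset.sum_const, hS,
      nsmul_eq_mul, Finset.mul_sum]
    intro q hq
    rw [if_pos hq, one_div, Real.log_inv, log_queryMeasure]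
    ring
  rw [h2] at h
  have h3 : 0 ≤ s * Real.log s := mul_nonneg hs0.le (Real.log_nonneg hs1')
  rw [div_le_iff₀ hs0]
  have h4 : η * ∑ q ∈ S, (xs.map fun x => payoff D x q).sum
      ≤ η * ((queryPlayerPayoff s η D Q xs + Real.log Q.card / η + xs.length * (η / 2)) * s) := by
    have : η * (Real.log Q.card / η) = Real.log Q.card := mul_div_cancel₀ _ hη.ne'
    nlinarith
  exact le_of_mul_le_mul_left h4 hη

lemma sum_payoff_database_list (hn : 0 < n) (D : Fin n → X) (qs : List (Query X)) :
    ∑ i, (qs.map fun q => payoff D (D i) q).sum = qs.length * (n / 2) := by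
  induction qs with
  | nil => simp
  | cons q qs ih =>
    simp only [List.map_cons, List.sum_cons, Finset.sum_add_distrib, sum_payoff_database hn,
      List.length_cons, ih]
    push_cast
    ring

variable [Fintype X] [Nonempty X]

lemma dataMeasure_sum_pos (η : ℝ) (D : Fin n → X) (qs : List (Query X)) :
    0 < ∑ x, dataMeasure η D qs x :=
  Finset.sum_pos (fun x _ => dataMeasure_pos η D qs x) Finset.univ_nonempty

lemma log_dataMeasure (η : ℝ) (D : Fin n → X) (qs : List (Query X)) (x : X) :
    Real.log (dataMeasure η D qs x)
      = -(Real.log (Fintype.card X) + η * (qs.map fun q => payoff D x q).sum) := by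
  induction qs with
  | nil => simp [dataMeasure]
  | cons q qs ih =>
    rw [dataMeasure, Real.log_mul (dataMeasure_pos η D qs x).ne' (Real.exp_pos _).ne',
      Real.log_exp, ih]
    simp only [List.map_cons, List.sum_cons]
    ring

/-- Jensen's inequality for `exp`, from its tangent line at the weighted mean. -/
lemma exp_weighted_mean_le {ι : Type*} [Fintype ι] {w : ι → ℝ} (hw : ∀ i, 0 ≤ w i)
    (hW : 0 < ∑ i, w i) (f : ι → ℝ) :
    Real.exp ((∑ i, w i * f i) / ∑ i, w i) * ∑ i, w i ≤ ∑ i, w i * Real.exp (f i) := by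
  set m := (∑ i, w i * f i) / ∑ i, w i with hm
  have h : ∀ i, w i * (Real.exp m * (1 + (f i - m))) ≤ w i * Real.exp (f i) := by
    intro i
    refine mul_le_mul_of_nonneg_left ?_ (hw i)
    have h1 := Real.add_one_le_exp (f i - m)
    have h2 : Real.exp (f i) = Real.exp m * Real.exp (f i - m) := by
      rw [← Real.exp_add]; ring_nf
    rw [h2]
    exact mul_le_mul_of_nonneg_left (by linarith) (Real.exp_pos m).le
  refine le_trans (le_of_eq ?_) (Finset.sum_le_sum fun i _ => h i)
  have h3 : ∑ i, w i * f i = m * ∑ i, w i := by rw [hm, div_mul_cancel₀ _ hW.ne']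
  have h4 : ∑ i, w i * (Real.exp m * (1 + (f i - m)))
      = Real.exp m * ((1 - m) * ∑ i, w i + ∑ i, w i * f i) := by
    rw [Finset.mul_sum, ← Finset.sum_add_distrib, Finset.mul_sum]
    exact Finset.sum_congr rfl fun i _ => by ring
  rw [h4, h3]
  ring

/-- Undoing the last update, by weights `e^{ηG}`, turns the new measure into the previous one.
Jensen's inequality for the new measure therefore bounds the payoff by the drop in log mass, without
a second-order error. -/
lemma dataPlayerPayoff_le_log {η : ℝ} (D : Fin n → X) (qs : List (Query X)) :
    η * dataPlayerPayoff η D qs ≤ -Real.log (∑ x, dataMeasure η D qs x) := by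
  induction qs with
  | nil => simp [dataPlayerPayoff, dataMeasure]
  | cons q qs ih =>
    have hW := dataMeasure_sum_pos η D (q :: qs)
    have h := exp_weighted_mean_le (fun x => (dataMeasure_pos η D (q :: qs) x).le) hW
      (fun x => η * payoff D x q)
    have h1 : ∑ x, dataMeasure η D (q :: qs) x * Real.exp (η * payoff D x q)
        = ∑ x, dataMeasure η D qs x := by
      refine Finset.sum_congr rfl fun x _ => ?_
      rw [dataMeasure, mul_assoc, ← Real.exp_add]
      simp
    have h2 : ∑ x, dataMeasure η D (q :: qs) x * (η * payoff D x q)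
        = η * ∑ x, dataMeasure η D (q :: qs) x * payoff D x q := by
      rw [Finset.mul_sum]
      exact Finset.sum_congr rfl fun x _ => by ring
    rw [h1, h2] at h
    have h3 := Real.log_le_log (mul_pos (Real.exp_pos _) hW) h
    rw [Real.log_mul (Real.exp_pos _).ne' hW.ne', Real.log_exp, mul_div_assoc] at h3
    rw [dataPlayerPayoff, mul_add]
    linarith

/-- Regret of the data player against the uniform distribution on the rows of `D`. -/
lemma dataPlayer_regret (hn : 0 < n) {η : ℝ} (hη : 0 < η) (D : Fin n → X) (qs : List (Query X)) :
    dataPlayerPayoff η D qs ≤ Real.log (Fintype.card X) / η + qs.length / 2 := by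
  have hn' : (0 : ℝ) < n := by exact_mod_cast hn
  have h1 : ∀ i, η * dataPlayerPayoff η D qs
      ≤ Real.log (Fintype.card X) + η * (qs.map fun q => payoff D (D i) q).sum := by
    intro i
    have h2 := Real.log_le_log (dataMeasure_pos η D qs (D i))
      (Finset.single_le_sum (fun x _ => (dataMeasure_pos η D qs x).le) (Finset.mem_univ (D i)))
    rw [log_dataMeasure] at h2
    linarith [dataPlayerPayoff_le_log (η := η) D qs]
  -- Averaging over the rows replaces their individual payoffs by 1/2 per round.
  have h3 := Finset.sum_le_sum fun i (_ : i ∈ Finset.univ) => h1 i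
  rw [Finset.sum_add_distrib, ← Finset.mul_sum _ _ η, ← Finset.mul_sum _ _ η,
    sum_payoff_database_list hn] at h3
  simp only [Finset.sum_const, Finset.card_univ, Fintype.card_fin, nsmul_eq_mul] at h3
  have h5 : η * dataPlayerPayoff η D qs ≤ Real.log (Fintype.card X) + η * (qs.length / 2) := by
    refine le_of_mul_le_mul_left ?_ hn'
    linarith
  have h6 : η * (Real.log (Fintype.card X) / η) = Real.log (Fintype.card X) :=
    mul_div_cancel₀ _ hη.ne'
  refine le_of_mul_le_mul_left ?_ hη
  linarith

end Regret

/-! ### Expectations under a `PMF` -/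

/-- The expectation of an `ℝ≥0∞`-valued function. -/
def expect {α : Type*} (p : PMF α) (f : α → ℝ≥0∞) : ℝ≥0∞ := ∑' a, p a * f a

lemma expect_pure {α : Type*} (a : α) (f : α → ℝ≥0∞) : expect (PMF.pure a) f = f a := by
  classical
  unfold expect
  rw [tsum_eq_single a fun b hb => by simp [PMF.pure_apply, hb]]
  simp

lemma expect_bind {α β : Type*} (p : PMF α) (g : α → PMF β) (f : β → ℝ≥0∞) :
    expect (p.bind g) f = expect p fun a => expect (g a) f := by
  simp only [expect, PMF.bind_apply, ← ENNReal.tsum_mul_right, ← ENNReal.tsum_mul_left]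
  rw [ENNReal.tsum_comm]
  exact tsum_congr fun a => tsum_congr fun b => by rw [mul_assoc]

lemma expect_mono {α : Type*} (p : PMF α) {f g : α → ℝ≥0∞} (h : ∀ a ∈ p.support, f a ≤ g a) :
    expect p f ≤ expect p g := by
  refine ENNReal.tsum_le_tsum fun a => ?_
  by_cases ha : a ∈ p.support
  · exact mul_le_mul_right (h a ha) _
  · rw [PMF.mem_support_iff, not_not] at ha
    simp [ha]

lemma expect_mul_right {α : Type*} (p : PMF α) (f : α → ℝ≥0∞) (c : ℝ≥0∞) :
    expect p (fun a => f a * c) = expect p f * c := by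
  simp only [expect, ← mul_assoc, ENNReal.tsum_mul_right]

lemma expect_sample {𝒜 : Type*} [Fintype 𝒜] [Nonempty 𝒜] (A : 𝒜 → ℝ) (hA : ∀ a, 0 < A a)
    {f : 𝒜 → ℝ} (hf : ∀ a, 0 ≤ f a) :
    expect (sample A hA) (fun a => ENNReal.ofReal (f a))
      = ENNReal.ofReal ((∑ a, A a * f a) / ∑ a, A a) := by
  have hW : 0 < ∑ a, A a := Finset.sum_pos (fun a _ => hA a) Finset.univ_nonempty
  simp only [expect, sample, PMF.normalize_apply, tsum_fintype]
  rw [← ENNReal.ofReal_sum_of_nonneg fun a _ => (hA a).le, ← ENNReal.ofReal_inv_of_pos hW,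
    Finset.sum_div, ENNReal.ofReal_sum_of_nonneg
      fun a _ => div_nonneg (mul_nonneg (hA a).le (hf a)) hW.le]
  refine Finset.sum_congr rfl fun a _ => ?_
  rw [← ENNReal.ofReal_mul (hA a).le,
    ← ENNReal.ofReal_mul (mul_nonneg (hA a).le (inv_nonneg.2 hW.le))]
  congr 1
  rw [div_eq_mul_inv]
  ring

/-! ### Concentration of the play -/

/-- A multiplicative update by factors in `[e^{-η}, 1]` changes the mean of a function with values
in `[-1, 1]` by at most `e^η - 1`. -/
lemma mean_update_le {ι : Type*} [Fintype ι] [Nonempty ι] {A g f : ι → ℝ} {η : ℝ} (hη : 0 ≤ η)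
    (hA : ∀ i, 0 < A i) (hg0 : ∀ i, 0 ≤ g i) (hg1 : ∀ i, g i ≤ 1) (hf : ∀ i, |f i| ≤ 1) :
    (∑ i, A i * Real.exp (-η * g i) * f i) / ∑ i, A i * Real.exp (-η * g i)
      ≤ (∑ i, A i * f i) / (∑ i, A i) + (Real.exp η - 1) := by
  have hB : ∀ i, 0 < A i * Real.exp (-η * g i) := fun i => mul_pos (hA i) (Real.exp_pos _)
  have hW : 0 < ∑ i, A i := Finset.sum_pos (fun i _ => hA i) Finset.univ_nonempty
  have hW' : 0 < ∑ i, A i * Real.exp (-η * g i) :=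
    Finset.sum_pos (fun i _ => hB i) Finset.univ_nonempty
  have hup : ∑ i, A i * Real.exp (-η * g i) ≤ ∑ i, A i :=
    Finset.sum_le_sum fun i _ => mul_le_of_le_one_right (hA i).le
      (Real.exp_le_one_iff.2 (by nlinarith [hg0 i]))
  have hexp : ∀ i, Real.exp (-η) ≤ Real.exp (-η * g i) := fun i =>
    Real.exp_le_exp.2 (by nlinarith [hg1 i])
  have hlow : Real.exp (-η) * ∑ i, A i ≤ ∑ i, A i * Real.exp (-η * g i) := by
    rw [Finset.mul_sum]
    exact Finset.sum_le_sum fun i _ => by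
      rw [mul_comm]; exact mul_le_mul_of_nonneg_left (hexp i) (hA i).le
  set W := ∑ i, A i with hWdef
  set W' := ∑ i, A i * Real.exp (-η * g i) with hWdef'
  have hE : Real.exp η * Real.exp (-η) = 1 := by rw [← Real.exp_add]; simp
  have hE1 : 1 ≤ Real.exp η := Real.one_le_exp hη
  have hr1 : W / W' ≤ Real.exp η := by
    rw [div_le_iff₀ hW']
    calc W = Real.exp η * (Real.exp (-η) * W) := by rw [← mul_assoc, hE, one_mul]
      _ ≤ _ := mul_le_mul_of_nonneg_left hlow (Real.exp_pos _).le
  have hr2 : 1 ≤ W / W' := by rwa [le_div_iff₀ hW', one_mul]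
  have key : ∀ i, A i / W * ((Real.exp (-η * g i) * (W / W') - 1) * f i)
      ≤ A i / W * (Real.exp η - 1) := by
    intro i
    refine mul_le_mul_of_nonneg_left ?_ (div_pos (hA i) hW).le
    refine (le_abs_self _).trans ?_
    rw [abs_mul]
    have h1 : |Real.exp (-η * g i) * (W / W') - 1| ≤ Real.exp η - 1 := by
      have h2 : Real.exp (-η * g i) ≤ 1 := Real.exp_le_one_iff.2 (by nlinarith [hg0 i])
      have h3 : Real.exp (-η * g i) * (W / W') ≤ Real.exp η :=
        (mul_le_of_le_one_left (by linarith) h2).trans hr1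
      have h4 : Real.exp (-η) ≤ Real.exp (-η * g i) * (W / W') :=
        (hexp i).trans (le_mul_of_one_le_right (Real.exp_pos _).le hr2)
      -- The deviation below 1 is at most `1 - e^{-η}`, which this shows to be at most `e^η - 1`.
      have h5 : 2 ≤ Real.exp η + Real.exp (-η) := by
        nlinarith [sq_nonneg (Real.exp η - 1), Real.exp_pos (-η)]
      rw [abs_le]
      constructor <;> linarith
    calc _ ≤ (Real.exp η - 1) * 1 :=
          mul_le_mul h1 (hf i) (abs_nonneg _) (by linarith)
      _ = _ := mul_one _
  have h := Finset.sum_le_sum fun i (_ : i ∈ Finset.univ) => key i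
  have h1 : ∑ i, A i / W * ((Real.exp (-η * g i) * (W / W') - 1) * f i)
      = (∑ i, A i * Real.exp (-η * g i) * f i) / W' - (∑ i, A i * f i) / W := by
    rw [Finset.sum_div Finset.univ (fun i => A i * Real.exp (-η * g i) * f i),
      Finset.sum_div Finset.univ (fun i => A i * f i), ← Finset.sum_sub_distrib]
    refine Finset.sum_congr rfl fun i _ => ?_
    field_simp
  have h2 : ∑ i, A i / W * (Real.exp η - 1) = Real.exp η - 1 := by
    rw [← Finset.sum_mul, ← Finset.sum_div, div_self hW.ne', one_mul]
  rw [h1, h2] at h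
  linarith

/-- The exponential moment of a function with values in `[-1, 1]`. -/
lemma mean_exp_le {ι : Type*} [Fintype ι] [Nonempty ι] {A f : ι → ℝ} {l : ℝ} (hl0 : 0 ≤ l)
    (hl1 : l ≤ 1) (hA : ∀ i, 0 < A i) (hf : ∀ i, |f i| ≤ 1) :
    (∑ i, A i * Real.exp (l * f i)) / ∑ i, A i
      ≤ 1 + l * ((∑ i, A i * f i) / ∑ i, A i) + l ^ 2 := by
  have hW : 0 < ∑ i, A i := Finset.sum_pos (fun i _ => hA i) Finset.univ_nonempty
  rw [div_le_iff₀ hW]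
  have key : ∀ i, A i * Real.exp (l * f i) ≤ A i * (1 + l ^ 2) + l * (A i * f i) := by
    intro i
    have h1 : |l * f i| ≤ l := by
      rw [abs_mul, abs_of_nonneg hl0]
      exact mul_le_of_le_one_right hl0 (hf i)
    have h2 := (abs_le.1 (Real.abs_exp_sub_one_sub_id_le (h1.trans hl1))).2
    have h3 : (l * f i) ^ 2 ≤ l ^ 2 := sq_le_sq.2 (h1.trans (le_abs_self l))
    have h4 : Real.exp (l * f i) ≤ 1 + l ^ 2 + l * f i := by linarith
    linarith [mul_le_mul_of_nonneg_left h4 (hA i).le]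
  refine (Finset.sum_le_sum fun i _ => key i).trans (le_of_eq ?_)
  rw [Finset.sum_add_distrib, ← Finset.sum_mul, ← Finset.mul_sum]
  field_simp
  ring

section Play

variable {X : Type u} [Fintype X] {n : ℕ}

/-- The payoff of the pure action `x` against the query player's mixed action. -/
def mixedQueryPayoff (s η : ℝ) (D : Fin n → X) (Q : Finset (Query X)) (xs : List X) (x : X) : ℝ :=
  (∑ q : Q, proj s (queryMeasure η D Q xs) q * payoff D x q)
    / ∑ q, proj s (queryMeasure η D Q xs) q

/-- The payoff of the pure action `q` against the data player's mixed action in response to `q`. -/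
def mixedDataPayoff (η : ℝ) (D : Fin n → X) (qs : List (Query X)) (q : Query X) : ℝ :=
  (∑ x, dataMeasure η D (q :: qs) x * payoff D x q) / ∑ x, dataMeasure η D (q :: qs) x

/-- The sum over the rounds of the difference between the payoff of the query player's mixed action
against the sampled record and that of the data player's mixed action against the sampled query. -/
def payoffGap (s η : ℝ) (D : Fin n → X) (Q : Finset (Query X)) : List Q → List X → ℝ
  | q :: qs, x :: xs => payoffGap s η D Q qs xs
      + (mixedQueryPayoff s η D Q xs x - mixedDataPayoff η D (qs.map Subtype.val) q)
  | _, _ => 0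

lemma weighted_mean_mem {ι : Type*} [Fintype ι] [Nonempty ι] {A f : ι → ℝ} (hA : ∀ i, 0 < A i)
    (hf0 : ∀ i, 0 ≤ f i) (hf1 : ∀ i, f i ≤ 1) :
    0 ≤ (∑ i, A i * f i) / ∑ i, A i ∧ (∑ i, A i * f i) / ∑ i, A i ≤ 1 := by
  have hW : 0 < ∑ i, A i := Finset.sum_pos (fun i _ => hA i) Finset.univ_nonempty
  refine ⟨div_nonneg (Finset.sum_nonneg fun i _ => mul_nonneg (hA i).le (hf0 i)) hW.le, ?_⟩
  rw [div_le_one hW]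
  exact Finset.sum_le_sum fun i _ => mul_le_of_le_one_right (hA i).le (hf1 i)

/-- The gap normalizes by the actual mass of the projection, so the tail bound needs no condition on
`s`; the regret bound normalizes by `s`. The two agree once `s ≤ |Q|`. -/
lemma payoffGap_eq {s η : ℝ} (hs : 1 ≤ s) (hη : 0 ≤ η) (D : Fin n → X) (Q : Finset (Query X))
    (hsQ : s ≤ Q.card) (qs : List Q) (xs : List X) (h : qs.length = xs.length) :
    payoffGap s η D Q qs xs
      = queryPlayerPayoff s η D Q xs - dataPlayerPayoff η D (qs.map Subtype.val) := by
  induction qs generalizing xs with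
  | nil =>
    rw [List.length_nil, eq_comm, List.length_eq_zero_iff] at h
    subst h
    simp [payoffGap, queryPlayerPayoff, dataPlayerPayoff]
  | cons q qs ih =>
    rcases xs with _ | ⟨x, xs⟩
    · simp at h
    · simp only [List.length_cons, Nat.add_right_cancel_iff] at h
      rw [payoffGap, ih xs h, queryPlayerPayoff, List.map_cons, dataPlayerPayoff,
        mixedQueryPayoff, mixedDataPayoff,
        (proj_spec (queryMeasure_pos η D Q xs) ((queryMeasure_sum_le hη D Q xs).trans hs)
          (by simpa using hsQ)).1]
      ring

variable [Nonempty X]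

/-- The record depends on the query through the data player's update, so its mean is compared with
the mean under the measure before the update, at a cost of `e^η - 1`. Before the update the two
averages are the same double average of the payoff, and their difference has mean zero over the
query. -/
lemma round_moment {s η l : ℝ} (hη : 0 ≤ η) (hl0 : 0 ≤ l) (hl1 : l ≤ 1) (D : Fin n → X)
    (Q : Finset (Query X)) [Nonempty Q] (qs : List Q) (xs : List X) :
    expect (sample (proj s (queryMeasure η D Q xs)) (proj_pos s (queryMeasure_pos η D Q xs)))
      (fun q => expect (sample (dataMeasure η D ((q :: qs).map Subtype.val))
          (dataMeasure_pos η D _)) fun x =>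
        ENNReal.ofReal (Real.exp (l * (mixedQueryPayoff s η D Q xs x
          - mixedDataPayoff η D (qs.map Subtype.val) q))))
      ≤ ENNReal.ofReal (Real.exp (l * (Real.exp η - 1) + l ^ 2)) := by
  have hP := proj_pos s (queryMeasure_pos η D Q xs)
  have hW : 0 < ∑ q, proj s (queryMeasure η D Q xs) q :=
    Finset.sum_pos (fun q _ => hP q) Finset.univ_nonempty
  have hV := dataMeasure_sum_pos η D (qs.map Subtype.val)
  set P := proj s (queryMeasure η D Q xs) with hPdef
  set qs' := qs.map Subtype.val with hqs'
  set h : X → ℝ := fun x => mixedQueryPayoff s η D Q xs x with hh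
  have hh01 : ∀ x, 0 ≤ h x ∧ h x ≤ 1 := fun x =>
    weighted_mean_mem hP (fun q => payoff_nonneg D x q) (fun q => payoff_le_one D x q)
  have hd01 : ∀ q, 0 ≤ mixedDataPayoff η D qs' q ∧ mixedDataPayoff η D qs' q ≤ 1 := fun q =>
    weighted_mean_mem (dataMeasure_pos η D (q :: qs')) (fun x => payoff_nonneg D x q)
      (fun x => payoff_le_one D x q)
  -- the mean after the data player's update, in terms of the mean before it
  set base : Q → ℝ := fun q =>
    (∑ x, dataMeasure η D qs' x * (h x - payoff D x q)) / ∑ x, dataMeasure η D qs' x with hbase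
  have hstep : ∀ q : Q,
      expect (sample (dataMeasure η D ((q :: qs).map Subtype.val)) (dataMeasure_pos η D _))
        (fun x => ENNReal.ofReal (Real.exp (l * (mixedQueryPayoff s η D Q xs x
          - mixedDataPayoff η D qs' q))))
      ≤ ENNReal.ofReal (1 + l * (Real.exp η - 1) + l ^ 2 + l * base q) := by
    intro q
    rw [expect_sample _ _ fun x => (Real.exp_pos _).le]
    refine ENNReal.ofReal_le_ofReal ?_
    rw [List.map_cons, ← hqs']
    have hA := dataMeasure_pos η D (q.1 :: qs')
    have hA' := dataMeasure_sum_pos η D (q.1 :: qs')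
    refine (mean_exp_le hl0 hl1 hA (f := fun x => h x - mixedDataPayoff η D qs' q)
      fun x => ?_).trans ?_
    · rw [abs_le]
      constructor <;> linarith [(hh01 x).1, (hh01 x).2, (hd01 q).1, (hd01 q).2]
    -- The mixed data payoff is itself a mean under the updated measure, so it may be replaced by
    -- the pure payoff inside the average.
    have h1 : (∑ x, dataMeasure η D (q.1 :: qs') x * (h x - mixedDataPayoff η D qs' q))
          / ∑ x, dataMeasure η D (q.1 :: qs') x
        = (∑ x, dataMeasure η D (q.1 :: qs') x * (h x - payoff D x q))
          / ∑ x, dataMeasure η D (q.1 :: qs') x := by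
      simp only [mul_sub, Finset.sum_sub_distrib, ← Finset.sum_mul, sub_div]
      rw [mul_div_cancel_left₀ _ hA'.ne', mixedDataPayoff]
    have h2 := mean_update_le (A := dataMeasure η D qs') (g := fun x => payoff D x q)
      (f := fun x => h x - payoff D x q) hη (dataMeasure_pos η D qs')
      (fun x => payoff_nonneg D x q) (fun x => payoff_le_one D x q) (fun x => by
        rw [abs_le]
        constructor <;> linarith [(hh01 x).1, (hh01 x).2, payoff_nonneg D x q.1,
          payoff_le_one D x q.1])
    rw [h1]
    have h3 := mul_le_mul_of_nonneg_left h2 hl0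
    simp only [dataMeasure]
    linarith
  have hbase1 : ∀ q, -1 ≤ base q := by
    intro q
    rw [hbase, le_div_iff₀ hV, neg_one_mul, ← Finset.sum_neg_distrib]
    refine Finset.sum_le_sum fun x _ => ?_
    nlinarith [(dataMeasure_pos η D qs' x), (hh01 x).1, payoff_le_one D x q.1]
  have hE1 : 1 ≤ Real.exp η := Real.one_le_exp hη
  have hnonneg : ∀ q, 0 ≤ 1 + l * (Real.exp η - 1) + l ^ 2 + l * base q := by
    intro q
    nlinarith [mul_le_mul_of_nonneg_left (hbase1 q) hl0, mul_nonneg hl0 (sub_nonneg.2 hE1)]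
  refine (expect_mono _ fun q _ => hstep q).trans ?_
  rw [expect_sample _ _ hnonneg]
  refine ENNReal.ofReal_le_ofReal ?_
  have hmean : ∑ q, P q * base q = 0 := by
    have h1 : ∀ q, P q * base q = (∑ x, dataMeasure η D qs' x * (P q * (h x - payoff D x q)))
        / ∑ x, dataMeasure η D qs' x := by
      intro q
      rw [hbase, mul_div_assoc', Finset.mul_sum]
      congr 1
      exact Finset.sum_congr rfl fun x _ => by ring
    simp only [h1]
    rw [← Finset.sum_div, Finset.sum_comm]
    have h2 : ∀ x, ∑ q, dataMeasure η D qs' x * (P q * (h x - payoff D x q)) = 0 := by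
      intro x
      rw [← Finset.mul_sum]
      simp only [mul_sub, Finset.sum_sub_distrib, ← Finset.sum_mul]
      have : (∑ q, P q) * h x = ∑ q : Q, P q * payoff D x q := by
        rw [hh]
        simp only [mixedQueryPayoff]
        rw [mul_div_cancel₀ _ hW.ne']
      rw [this]
      ring
    rw [Finset.sum_eq_zero fun x _ => h2 x, zero_div]
  have h1 : ∑ q, P q * (1 + l * (Real.exp η - 1) + l ^ 2 + l * base q)
      = (1 + l * (Real.exp η - 1) + l ^ 2) * ∑ q, P q := by
    have : ∀ q, P q * (1 + l * (Real.exp η - 1) + l ^ 2 + l * base q)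
        = (1 + l * (Real.exp η - 1) + l ^ 2) * P q + l * (P q * base q) := fun q => by ring
    simp only [this, Finset.sum_add_distrib, ← Finset.mul_sum, hmean, mul_zero, add_zero]
  rw [h1, mul_div_cancel_right₀ _ hW.ne']
  linarith [Real.add_one_le_exp (l * (Real.exp η - 1) + l ^ 2)]

/-- Conditioning on the past, the exponential of the earlier gap factors out and `round_moment`
bounds the new factor uniformly. -/
lemma play_moment {s η l : ℝ} (hη : 0 ≤ η) (hl0 : 0 ≤ l) (hl1 : l ≤ 1) (D : Fin n → X)
    (Q : Finset (Query X)) (hQ : Q.Nonempty) (t : ℕ) :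
    expect (play s η D Q hQ t)
        (fun h => ENNReal.ofReal (Real.exp (l * payoffGap s η D Q h.queries h.records)))
      ≤ ENNReal.ofReal (Real.exp (t * (l * (Real.exp η - 1) + l ^ 2))) := by
  have : Nonempty Q := hQ.to_subtype
  induction t with
  | zero => simp [play, expect_pure, payoffGap]
  | succ t ih =>
    rw [play]
    simp only [expect_bind, expect_pure]
    have h1 : ∀ h : Transcript X Q,
        expect (sample (proj s (queryMeasure η D Q h.records))
            (proj_pos s (queryMeasure_pos η D Q h.records)))
          (fun q => expect (sample (dataMeasure η D ((q :: h.queries).map Subtype.val))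
            (dataMeasure_pos η D _)) fun x =>
          ENNReal.ofReal (Real.exp (l * payoffGap s η D Q (q :: h.queries) (x :: h.records))))
        ≤ ENNReal.ofReal (Real.exp (l * payoffGap s η D Q h.queries h.records))
          * ENNReal.ofReal (Real.exp (l * (Real.exp η - 1) + l ^ 2)) := by
      intro h
      have h2 : ∀ q x, ENNReal.ofReal (Real.exp
            (l * payoffGap s η D Q (q :: h.queries) (x :: h.records)))
          = ENNReal.ofReal (Real.exp (l * (mixedQueryPayoff s η D Q h.records x
            - mixedDataPayoff η D (h.queries.map Subtype.val) q)))
            * ENNReal.ofReal (Real.exp (l * payoffGap s η D Q h.queries h.records)) := by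
        intro q x
        rw [← ENNReal.ofReal_mul (Real.exp_pos _).le, ← Real.exp_add, payoffGap]
        ring_nf
      simp only [h2, expect_mul_right]
      rw [mul_comm]
      exact mul_le_mul_right (round_moment hη hl0 hl1 D Q h.queries h.records) _
    refine (expect_mono _ fun h _ => h1 h).trans ?_
    rw [expect_mul_right]
    refine (mul_le_mul_left ih _).trans (le_of_eq ?_)
    rw [← ENNReal.ofReal_mul (Real.exp_pos _).le, ← Real.exp_add]
    push_cast
    ring_nf

lemma play_length {s η : ℝ} (D : Fin n → X) (Q : Finset (Query X)) (hQ : Q.Nonempty) (t : ℕ) :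
    ∀ h ∈ (play s η D Q hQ t).support, h.queries.length = t ∧ h.records.length = t := by
  induction t with
  | zero =>
    intro h hh
    simp only [play, PMF.support_pure, Set.mem_singleton_iff] at hh
    simp [hh]
  | succ t ih =>
    intro h hh
    simp only [play, PMF.mem_support_bind_iff, PMF.support_pure, Set.mem_singleton_iff] at hh
    obtain ⟨h', hh', q, _, x, _, rfl⟩ := hh
    simp [ih h' hh']

/-- The tail bound for the payoff gap. -/
lemma play_tail {s η l v : ℝ} (hη : 0 ≤ η) (hl0 : 0 ≤ l) (hl1 : l ≤ 1) (D : Fin n → X)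
    (Q : Finset (Query X)) (hQ : Q.Nonempty) (t : ℕ) :
    1 - ENNReal.ofReal (Real.exp (t * (l * (Real.exp η - 1) + l ^ 2) - l * v))
      ≤ (play s η D Q hQ t).toMeasure {h | h.queries.length = t ∧ h.records.length = t ∧
        payoffGap s η D Q h.queries h.records ≤ v} := by
  set E : Set (Transcript X Q) := {h | h.queries.length = t ∧ h.records.length = t ∧
        payoffGap s η D Q h.queries h.records ≤ v} with hE
  have hm : MeasurableSet E := trivial
  rw [tsub_le_iff_right, ← prob_add_prob_compl (μ := (play s η D Q hQ t).toMeasure) hm]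
  refine add_le_add_right ?_ _
  rw [PMF.toMeasure_apply _ hm.compl]
  -- Markov's inequality for the exponential moment. Transcripts of the wrong length, on which the
  -- gap carries no information, have probability zero.
  have h1 : ∑' h, Eᶜ.indicator (play s η D Q hQ t) h
      ≤ expect (play s η D Q hQ t) (fun h =>
        ENNReal.ofReal (Real.exp (l * payoffGap s η D Q h.queries h.records))
          * ENNReal.ofReal (Real.exp (-(l * v)))) := by
    refine ENNReal.tsum_le_tsum fun h => ?_
    by_cases hh : h ∈ Eᶜ
    · rw [Set.indicator_of_mem hh]
      by_cases hs : h ∈ (play s η D Q hQ t).support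
      · have hl := play_length D Q hQ t h hs
        have hv : v < payoffGap s η D Q h.queries h.records := by
          by_contra hcon
          exact hh ⟨hl.1, hl.2, not_lt.1 hcon⟩
        simp only [← ENNReal.ofReal_mul (Real.exp_pos _).le, ← Real.exp_add]
        refine le_mul_of_one_le_right zero_le ?_
        rw [ENNReal.one_le_ofReal]
        exact Real.one_le_exp (by nlinarith)
      · rw [PMF.mem_support_iff, not_not] at hs
        simp [hs]
    · rw [Set.indicator_of_notMem hh]
      exact zero_le
  refine h1.trans ?_
  rw [expect_mul_right]
  refine (mul_le_mul_left (play_moment hη hl0 hl1 D Q hQ t) _).trans (le_of_eq ?_)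
  rw [← ENNReal.ofReal_mul (Real.exp_pos _).le, ← Real.exp_add]
  ring_nf

end Play

/-! ### Laplace noise and sparse vector -/

instance : SigmaFinite laplace := by
  unfold laplace
  infer_instance

lemma laplace_Ioo {L : ℝ} (hL : 0 ≤ L) :
    laplace (Set.Ioo (-L) L) = ENNReal.ofReal (1 - Real.exp (-L)) := by
  have hcont : Continuous fun z : ℝ => Real.exp (-|z|) / 2 := by fun_prop
  rw [laplace, withDensity_apply _ measurableSet_Ioo, restrict_Ioo_eq_restrict_Ioc,
    ← ofReal_integral_eq_lintegral_ofReal (hcont.integrableOn_Ioc)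
      (Filter.Eventually.of_forall fun z => by positivity),
    ← intervalIntegral.integral_of_le (by linarith)]
  congr 1
  rw [← intervalIntegral.integral_add_adjacent_intervals (b := 0)
    (hcont.intervalIntegrable _ _) (hcont.intervalIntegrable _ _)]
  have h1 : ∫ z in (0 : ℝ)..L, Real.exp (-|z|) / 2 = (1 - Real.exp (-L)) / 2 := by
    rw [intervalIntegral.integral_congr (g := fun z => Real.exp (-z) / 2)]
    · rw [intervalIntegral.integral_div, intervalIntegral.integral_comp_neg, integral_exp]
      simp
    · intro z hz
      rw [Set.uIcc_of_le hL] at hz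
      simp only [abs_of_nonneg hz.1]
  have h2 : ∫ z in (-L)..(0 : ℝ), Real.exp (-|z|) / 2 = ∫ z in (0 : ℝ)..L, Real.exp (-|z|) / 2 := by
    have h3 := intervalIntegral.integral_comp_neg (a := 0) (b := L)
      (f := fun z : ℝ => Real.exp (-|z|) / 2)
    simp only [abs_neg, neg_zero] at h3
    exact h3.symm
  rw [h2, h1]
  ring

lemma pi_laplace_ge {ι : Type*} [Fintype ι] {L : ℝ} (hL : 0 ≤ L) :
    ENNReal.ofReal (1 - Fintype.card ι * Real.exp (-L))
      ≤ (Measure.pi fun _ : ι => laplace) {z | ∀ i, |z i| < L} := by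
  have h : {z : ι → ℝ | ∀ i, |z i| < L} = Set.univ.pi fun _ => Set.Ioo (-L) L := by
    ext z
    simp [abs_lt]
  have he : Real.exp (-L) ≤ 1 := Real.exp_le_one_iff.2 (by linarith)
  rw [h, Measure.pi_pi, Finset.prod_const, Finset.card_univ, laplace_Ioo hL,
    ← ENNReal.ofReal_pow (by linarith)]
  refine ENNReal.ofReal_le_ofReal ?_
  -- By independence the probability is a power of `1 - e^{-L}`; Bernoulli's inequality gives the
  -- union bound.
  have h1 := one_add_mul_le_pow (a := -Real.exp (-L)) (by linarith) (Fintype.card ι)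
  rw [← sub_eq_add_neg] at h1
  linarith

section SparseVector

variable {ι : Type*} [Fintype ι] {f : ι → ℝ} {θ b : ℝ} {k : ℕ} {z : ι → ℝ}

lemma le_of_mem_sparseVector {i : ι} (hi : i ∈ sparseVector f θ b k z) : θ ≤ f i + b * z i := by
  classical
  unfold sparseVector at hi
  have := List.mem_of_mem_take (List.mem_toFinset.1 hi)
  simpa using this

lemma sparseVector_card_le : (sparseVector f θ b k z).card ≤ k := by
  classical
  unfold sparseVector
  exact (List.toFinset_card_le _).trans (List.length_take_le _ _)

/-- Sparse vector returns every index that passes if at most `k` do. -/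
lemma mem_sparseVector {B : Finset ι} (hB : ∀ i, θ ≤ f i + b * z i → i ∈ B) (hk : B.card ≤ k)
    {i : ι} (hi : θ ≤ f i + b * z i) : i ∈ sparseVector f θ b k z := by
  classical
  unfold sparseVector
  rw [List.take_of_length_le]
  · simpa using hi
  · rw [← List.toFinset_card_of_nodup ((Finset.nodup_toList _).filter _)]
    refine (Finset.card_le_card fun j hj => hB j ?_).trans hk
    simpa using hj

end SparseVector

/-! ### The equilibrium leaves few queries with a large error -/

section Equilibrium

variable {X : Type u} [Fintype X] {n : ℕ}

lemma rounds_pos (n : ℕ) (Q : Finset (Query X)) : (0 : ℝ) < rounds n Q := by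
  have : 1 ≤ rounds n Q := le_max_left _ _
  exact_mod_cast this

lemma le_rounds (n : ℕ) (Q : Finset (Query X)) : n * logSize Q ≤ rounds n Q :=
  (Nat.le_ceil _).trans (by exact_mod_cast le_max_right _ _)

lemma logSize_nonneg (Q : Finset (Query X)) : 0 ≤ logSize Q :=
  (Real.log_natCast_nonneg _).trans (le_max_left _ _)

lemma learningRate_pos (n : ℕ) (Q : Finset (Query X)) {ε δ : ℝ} (hε : 0 < ε) (hδ : 0 < δ)
    (hδ1 : δ < 1) : 0 < learningRate n Q ε δ := by
  have := rounds_pos n Q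
  have : 0 < Real.log (1 / δ) := Real.log_pos (by rwa [lt_div_iff₀ hδ, one_mul])
  unfold learningRate
  positivity

lemma learningRate_le_equilibriumError (n : ℕ) (Q : Finset (Query X)) {ε δ β' : ℝ} (hε : 0 < ε)
    (hδ : 0 < δ) (hδ1 : δ < 1) (hβ : 0 < β') (hβ1 : β' ≤ 1) :
    4 * learningRate n Q ε δ ≤ equilibriumError n Q ε δ β' := by
  have h1 : 0 ≤ logSize Q / (learningRate n Q ε δ * rounds n Q) :=
    div_nonneg (logSize_nonneg Q)
      (mul_pos (learningRate_pos n Q hε hδ hδ1) (rounds_pos n Q)).le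
  have h2 : 0 ≤ 4 * Real.log (2 / β') / √(rounds n Q) := by
    have : 0 ≤ Real.log (2 / β') := Real.log_nonneg (by rw [le_div_iff₀ hβ]; linarith)
    positivity
  unfold equilibriumError
  linarith

/-- The threshold on the payoff gap below which the plays are in approximate equilibrium. -/
def gapBound (n : ℕ) (Q : Finset (Query X)) (ε δ β' : ℝ) : ℝ :=
  3 / 2 * (learningRate n Q ε δ * rounds n Q) + 8 * √(rounds n Q) * Real.log (2 / β')

/-- The queries on which the synthetic database errs by more than the equilibrium error. -/
def badQueries (n : ℕ) (Q : Finset (Query X)) (ε δ β' : ℝ) (D : Fin n → X) (S : List X) :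
    Finset Q :=
  Finset.univ.filter fun q : Q =>
    equilibriumError n Q ε δ β' < onDatabase q.1 D - onSynthetic q.1 S

lemma badQueries_eq_empty {Q : Finset (Query X)} {ε δ β' : ℝ} {D : Fin n → X} {S : List X}
    (h : 1 ≤ equilibriumError n Q ε δ β') : badQueries n Q ε δ β' D S = ∅ := by
  refine Finset.filter_eq_empty_iff.2 fun q _ => ?_
  linarith [onDatabase_le_one q.1 D, onSynthetic_nonneg q.1 S]

variable [Nonempty X]

/-- Uniform play on `s` bad queries would earn more than `T(1 + 4ρ)/2`. Subtracting both regret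
bounds leaves a gap above `2ρT - 2M/η - ηT/2`, which is exactly `gapBound`. An excess of bad queries
also forces `s ≤ |Q|`, as the projection requires. -/
lemma card_badQueries_le (hn : 0 < n) (Q : Finset (Query X)) {ε δ β' : ℝ} (hε : 0 < ε) (hδ : 0 < δ)
    (hδ1 : δ < 1) (D : Fin n → X) {qs : List Q} {xs : List X}
    (hqs : qs.length = rounds n Q) (hxs : xs.length = rounds n Q)
    (hgap : payoffGap (density n Q) (learningRate n Q ε δ) D Q qs xs ≤ gapBound n Q ε δ β') :
    (badQueries n Q ε δ β' D xs).card ≤ density n Q := by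
  by_contra! hcon
  obtain ⟨S, hSB, hS⟩ := Finset.exists_subset_card_eq hcon.le
  have hη := learningRate_pos n Q hε hδ hδ1
  have hT := rounds_pos n Q
  have hs1 : 1 ≤ density n Q := by
    have : 1 ≤ rounds n Q := le_max_left _ _
    unfold density
    omega
  have hs0 : (0 : ℝ) < density n Q := by exact_mod_cast hs1
  have hsQ : (density n Q : ℝ) ≤ Q.card := by
    have := Finset.card_le_univ S
    rw [Fintype.card_coe, hS] at this
    exact_mod_cast this
  rw [payoffGap_eq (by exact_mod_cast hs1) hη.le D Q hsQ qs xs (hqs.trans hxs.symm)] at hgap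
  have hR := queryPlayer_regret hs1 hη D Q S hS xs
  have hR' := dataPlayer_regret hn hη D (qs.map Subtype.val)
  rw [List.length_map, hqs] at hR'
  rw [hxs] at hR
  have hlow : (rounds n Q : ℝ) * (1 + equilibriumError n Q ε δ β') / 2
      < (∑ q ∈ S, (xs.map fun x => payoff D x q).sum) / density n Q := by
    rw [lt_div_iff₀ hs0]
    have h1 : ∑ q ∈ S, (rounds n Q : ℝ) * (1 + equilibriumError n Q ε δ β') / 2
        < ∑ q ∈ S, (xs.map fun x => payoff D x q).sum := by
      refine Finset.sum_lt_sum_of_nonempty (Finset.card_pos.1 (by omega)) fun q hq => ?_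
      have h2 := (Finset.mem_filter.1 (hSB hq)).2
      rw [sum_payoff_list, hxs]
      have := mul_lt_mul_of_pos_left h2 hT
      linarith
    rw [Finset.sum_const, hS, nsmul_eq_mul] at h1
    linarith
  have hX : Real.log (Fintype.card X) / learningRate n Q ε δ ≤ logSize Q / learningRate n Q ε δ :=
    div_le_div_of_nonneg_right (le_max_left _ _) hη.le
  have hQ : Real.log Q.card / learningRate n Q ε δ ≤ logSize Q / learningRate n Q ε δ :=
    div_le_div_of_nonneg_right (le_max_right _ _) hη.le
  have hρ : (rounds n Q : ℝ) * equilibriumError n Q ε δ β'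
      = 4 * (learningRate n Q ε δ * rounds n Q + logSize Q / learningRate n Q ε δ
        + 4 * √(rounds n Q) * Real.log (2 / β')) := by
    have h1 : (rounds n Q : ℝ) / √(rounds n Q) = √(rounds n Q) := Real.div_sqrt
    have h2 : (rounds n Q : ℝ) * (logSize Q / (learningRate n Q ε δ * rounds n Q))
        = logSize Q / learningRate n Q ε δ := by
      field_simp
    have h3 : (rounds n Q : ℝ) * (4 * Real.log (2 / β') / √(rounds n Q))
        = 4 * Real.log (2 / β') * (rounds n Q / √(rounds n Q)) := by ring
    rw [h1] at h3
    unfold equilibriumError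
    linarith
  unfold gapBound at hgap
  linarith

lemma log_two_div_third {β : ℝ} (hβ : 0 < β) (hβ1 : β ≤ 1) :
    1 ≤ Real.log (2 / (β / 3)) ∧ Real.exp (-Real.log (2 / (β / 3))) = β / 6 := by
  constructor
  · rw [Real.le_log_iff_exp_le (by positivity), le_div_iff₀ (by positivity)]
    nlinarith [Real.exp_one_lt_d9, Real.exp_pos 1]
  · rw [← Real.log_inv, Real.exp_log (by positivity)]
    field_simp
    norm_num

/-- With high probability few queries are bad. -/
lemma play_card_badQueries_le (hn : 0 < n) (Q : Finset (Query X)) (hQ : Q.Nonempty) {ε δ β : ℝ}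
    (hε : 0 < ε) (hδ : 0 < δ) (hδ1 : δ < 1) (hβ : 0 < β) (hβ1 : β ≤ 1) (D : Fin n → X) :
    ENNReal.ofReal (1 - β / 3)
      ≤ (play (density n Q) (learningRate n Q ε δ) D Q hQ (rounds n Q)).toMeasure
        {h | h.records.length = rounds n Q ∧
          (badQueries n Q ε δ (β / 3) D h.records).card ≤ density n Q} := by
  have hη := learningRate_pos n Q hε hδ hδ1
  have hT := rounds_pos n Q
  -- For `η ≤ 1/4`, `e^η - 1 ≤ 3η/2` matches the first term of `gapBound`. For larger `η` the
  -- equilibrium error exceeds 1 and no query can be bad.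
  rcases le_or_gt (learningRate n Q ε δ) (1 / 4) with hη4 | hη4
  · have hT1 : (1 : ℝ) ≤ rounds n Q := by exact_mod_cast le_max_left _ _
    have hr : 1 ≤ √(rounds n Q : ℝ) := Real.one_le_sqrt.2 hT1
    -- The choice `l = 1/√T` makes `T l² = 1`. The exponent is then at most `1 - 8L ≤ -L` with `L =
    -- log(6/β) ≥ 1`.
    have htail := play_tail (s := density n Q) (l := 1 / √(rounds n Q))
      (v := gapBound n Q ε δ (β / 3)) hη.le (by positivity)
      (by rw [div_le_one (by linarith)]; exact hr) D Q hQ (rounds n Q)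
    refine le_trans ?_ (htail.trans (measure_mono fun h hh =>
      ⟨hh.2.1, card_badQueries_le hn Q hε hδ hδ1 D hh.1 hh.2.1 hh.2.2⟩))
    rw [← ENNReal.ofReal_one, ← ENNReal.ofReal_sub _ (Real.exp_pos _).le]
    refine ENNReal.ofReal_le_ofReal (sub_le_sub_left ?_ 1)
    obtain ⟨hL1, hL⟩ := log_two_div_third hβ hβ1
    refine le_trans (Real.exp_le_exp.2 ?_) (hL.le.trans (by linarith))
    have hsq : (rounds n Q : ℝ) = √(rounds n Q) ^ 2 := (Real.sq_sqrt hT.le).symm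
    unfold gapBound
    generalize learningRate n Q ε δ = η at *
    have he : Real.exp η - 1 ≤ 3 / 2 * η := by
      have h1 := (abs_le.1 (Real.abs_exp_sub_one_sub_id_le (x := η)
        (by rw [abs_of_pos hη]; linarith))).2
      nlinarith
    generalize Real.log (2 / (β / 3)) = L at *
    generalize √(rounds n Q : ℝ) = r at *
    rw [hsq]
    have hr0 : r ≠ 0 := by positivity
    have h1 : r ^ 2 * (1 / r * (Real.exp η - 1) + (1 / r) ^ 2)
        - 1 / r * (3 / 2 * (η * r ^ 2) + 8 * r * L)
        = r * (Real.exp η - 1 - 3 / 2 * η) + 1 - 8 * L := by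
      field_simp
      ring
    rw [h1]
    nlinarith
  · have h1 : (play (density n Q) (learningRate n Q ε δ) D Q hQ (rounds n Q)).toMeasure
        {h | h.records.length = rounds n Q ∧
          (badQueries n Q ε δ (β / 3) D h.records).card ≤ density n Q} = 1 := by
      rw [PMF.toMeasure_apply_eq_one_iff _ (show @MeasurableSet _ ⊤ _ from trivial)]
      intro h hh
      refine ⟨(play_length D Q hQ _ h hh).2, ?_⟩
      rw [badQueries_eq_empty]
      · simp
      · have := learningRate_le_equilibriumError n Q hε hδ hδ1 (β' := β / 3) (by linarith)
          (by linarith)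
        linarith
    rw [h1, ENNReal.ofReal_le_one]
    linarith

end Equilibrium

/-! ### The evaluated answers -/

section Answers

lemma noiseScale_mono {ε δ Δ : ℝ} (hε : 0 < ε) (hδ : 0 < δ) (hδ1 : δ ≤ 1) (hΔ : 0 ≤ Δ) {k l : ℕ}
    (h : k ≤ l) : noiseScale ε δ Δ k ≤ noiseScale ε δ Δ l := by
  have : 0 ≤ Real.log (1 / δ) := Real.log_nonneg (by rwa [le_div_iff₀ hδ, one_mul])
  have : (k : ℝ) ≤ l := by exact_mod_cast h
  unfold noiseScale
  gcongr

variable {X : Type u} {n m : ℕ}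

lemma mem_withNegations_negate {S : Finset (Query X)} {q : Query X} (hq : q ∈ withNegations S) :
    negate q ∈ withNegations S := by
  classical
  simp only [withNegations, Finset.mem_union, Finset.mem_image] at hq ⊢
  rcases hq with hq | ⟨q', hq', rfl⟩
  · exact Or.inr ⟨q, hq, rfl⟩
  · rw [negate_negate]
    exact Or.inl hq'

lemma mem_allQueries {Qs : Fin m → Finset (Query X)} {j : Fin m} {q : Query X}
    (hq : q ∈ withNegations (Qs j)) : q ∈ allQueries Qs := by
  classical
  exact Finset.mem_biUnion.2 ⟨j, Finset.mem_univ j, hq⟩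

variable [Fintype X]

lemma noiseScale_density_pos (hn : 0 < n) (Q : Finset (Query X)) {ε δ : ℝ} (hε : 0 < ε)
    (hδ : 0 < δ) (hδ1 : δ < 1) : 0 < noiseScale (ε / 3) (δ / 3) (1 / n) (density n Q) := by
  have hn' : (0 : ℝ) < n := by exact_mod_cast hn
  have h1 : 0 < Real.log (1 / (δ / 3)) :=
    Real.log_pos (by rw [lt_div_iff₀ (by positivity)]; linarith)
  have h2 : (0 : ℝ) < density n Q := by
    have : 1 ≤ rounds n Q := le_max_left _ _
    unfold density
    exact_mod_cast (by omega : 0 < 12 * rounds n Q)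
  unfold noiseScale
  positivity

/-- A noisy answer is used only if some query is truly bad. This extra conclusion rules out noisy
answers when `Q` has a single element. -/
lemma evaluate_error {κ ε δ β L : ℝ} (hκ : 0 < κ) (hn : 0 < n) (hε : 0 < ε) (hδ : 0 < δ)
    (hδ1 : δ < 1) (Qs : Fin m → Finset (Query X)) (D : Fin n → X)
    (hL : L = Real.log ((allQueries Qs).card / (β / 3)))
    (ω : Coins X (allQueries Qs)) (hlen : ω.1.records.length = rounds n (allQueries Qs))
    (hbad : (badQueries n (allQueries Qs) ε δ (β / 3) D ω.1.records).card
      ≤ density n (allQueries Qs))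
    (hz : ∀ q, |ω.2.1 q| < L) (hw : ∀ q, |ω.2.2 q| < L) (j : Fin m) {q : Query X}
    (hq : q ∈ withNegations (Qs j)) :
    (evaluate (mechanism κ Qs ε δ β D ω j) q = onSynthetic q ω.1.records ∧
      |onSynthetic q ω.1.records - onDatabase q D|
        ≤ equilibriumError n (allQueries Qs) ε δ (β / 3)
          + 2 * (svScale κ n (allQueries Qs) ε δ * L)) ∨
    ((∃ q' ∈ allQueries Qs, equilibriumError n (allQueries Qs) ε δ (β / 3)
        < onDatabase q' D - onSynthetic q' ω.1.records) ∧
      |evaluate (mechanism κ Qs ε δ β D ω j) q - onDatabase q D|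
        ≤ noiseScale (ε / 3) (δ / 3) (1 / n) (density n (allQueries Qs)) * L) := by
  have hlam := noiseScale_density_pos hn (allQueries Qs) hε hδ hδ1
  have hb : 0 < svScale κ n (allQueries Qs) ε δ := mul_pos hκ hlam
  have hne : ω.1.records ≠ [] := by
    intro h
    rw [h, List.length_nil] at hlen
    have := rounds_pos n (allQueries Qs)
    rw [← hlen] at this
    simp at this
  set F := flagged κ (allQueries Qs) ε δ β D ω with hF
  have hpass : ∀ a : allQueries Qs, svThreshold κ n (allQueries Qs) ε δ β
      ≤ onDatabase a.1 D - onSynthetic a.1 (synthetic ω)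
        + svScale κ n (allQueries Qs) ε δ * ω.2.1 a →
      equilibriumError n (allQueries Qs) ε δ (β / 3)
        < onDatabase a.1 D - onSynthetic a.1 ω.1.records := by
    intro a ha
    rw [synthetic, onSynthetic_reverse, svThreshold, ← hL] at ha
    have := mul_lt_mul_of_pos_left (abs_lt.1 (hz a)).2 hb
    linarith
  -- Every index that passes is bad, so at most `s` pass and none is lost to the cutoff. The slack
  -- `bL` of the threshold and the noise bound `bL` add up to `2bL`.
  have hnot : ∀ a : allQueries Qs, a ∉ F → onDatabase a.1 D - onSynthetic a.1 ω.1.records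
      ≤ equilibriumError n (allQueries Qs) ε δ (β / 3)
        + 2 * (svScale κ n (allQueries Qs) ε δ * L) := by
    intro a ha
    by_contra! hcon
    refine ha (mem_sparseVector (B := badQueries n (allQueries Qs) ε δ (β / 3) D ω.1.records)
      (fun i hi => Finset.mem_filter.2 ⟨Finset.mem_univ i, hpass i hi⟩) hbad ?_)
    rw [synthetic, onSynthetic_reverse, svThreshold, ← hL]
    have := mul_lt_mul_of_pos_left (abs_lt.1 (hz a)).1 hb
    linarith
  have hans : ∀ a : allQueries Qs, |laplaceAnswer κ (allQueries Qs) ε δ β D ω a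
      - onDatabase a.1 D|
        ≤ noiseScale (ε / 3) (δ / 3) (1 / n) (density n (allQueries Qs)) * L := by
    intro a
    have h0 : 0 ≤ noiseScale (ε / 3) (δ / 3) (1 / n) F.card := by
      unfold noiseScale
      positivity
    rw [laplaceAnswer, add_sub_cancel_left, abs_mul, ← hF, abs_of_nonneg h0]
    exact mul_le_mul (noiseScale_mono (by positivity) (by positivity) (by linarith)
      (by positivity) sparseVector_card_le) (hw a).le (abs_nonneg _) hlam.le
  have hqA := mem_allQueries hq
  have hq' := mem_withNegations_negate hq
  have hqA' := mem_allQueries hq'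
  by_cases h1 : (⟨q, hqA⟩ : allQueries Qs) ∈ F
  · right
    have he : evaluate (mechanism κ Qs ε δ β D ω j) q
        = laplaceAnswer κ (allQueries Qs) ε δ β D ω ⟨q, hqA⟩ := by
      simp [evaluate, mechanism, hqA, hq, ← hF, h1]
    refine ⟨⟨q, hqA, hpass ⟨q, hqA⟩ (le_of_mem_sparseVector h1)⟩, ?_⟩
    rw [he]
    exact hans ⟨q, hqA⟩
  · by_cases h2 : (⟨negate q, hqA'⟩ : allQueries Qs) ∈ F
    · right
      have he : evaluate (mechanism κ Qs ε δ β D ω j) q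
          = 1 - laplaceAnswer κ (allQueries Qs) ε δ β D ω ⟨negate q, hqA'⟩ := by
        simp [evaluate, mechanism, hqA, hqA', hq', ← hF, h1, h2]
      refine ⟨⟨negate q, hqA', hpass ⟨_, hqA'⟩ (le_of_mem_sparseVector h2)⟩, ?_⟩
      have h3 := hans ⟨negate q, hqA'⟩
      rw [onDatabase_negate hn, abs_sub_comm] at h3
      rw [he]
      convert h3 using 2
      ring
    · left
      have he : evaluate (mechanism κ Qs ε δ β D ω j) q = onSynthetic q ω.1.records := by
        simp [evaluate, mechanism, hqA, hqA', ← hF, h1, h2, synthetic, onSynthetic_reverse]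
      refine ⟨he, ?_⟩
      -- The bounds for `q` and for `¬q` control the two signs of the error.
      have h3 := hnot _ h1
      have h4 := hnot _ h2
      rw [onDatabase_negate hn, onSynthetic_negate hne] at h4
      rw [abs_le]
      constructor <;> linarith

end Answers

/-! ### The size of the error -/

section ErrorBound

variable {X : Type u} [Fintype X] {n : ℕ}

/-- `N ≥ 2` keeps `log(N/β)` at least 1/2, so the additive `log 3 ≤ 2` is absorbed into the factor
5. -/
lemma log_div_third {N β : ℝ} (hN : 2 ≤ N) (hβ : 0 < β) (hβ1 : β ≤ 1) :
    1 / 2 ≤ Real.log (N / β) ∧ Real.log (2 / (β / 3)) ≤ 5 * Real.log (N / β)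
      ∧ Real.log (N / (β / 3)) ≤ 5 * Real.log (N / β) := by
  have h2 : 1 / 2 ≤ Real.log 2 := by linarith [Real.log_two_gt_d9]
  have h1 : Real.log 2 ≤ Real.log (N / β) := by
    apply Real.log_le_log two_pos
    rw [le_div_iff₀ hβ]
    nlinarith
  have h3 : Real.log 3 ≤ 2 := by
    rw [Real.log_le_iff_le_exp three_pos]
    nlinarith [Real.add_one_le_exp 1, Real.add_one_le_exp 2]
  have h4 : Real.log (N / (β / 3)) = Real.log 3 + Real.log (N / β) := by
    rw [← Real.log_mul three_ne_zero (by positivity)]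
    congr 1
    field_simp
  have h5 : Real.log (2 / (β / 3)) ≤ Real.log (N / (β / 3)) :=
    Real.log_le_log (by positivity) (by gcongr)
  refine ⟨by linarith, by linarith, by linarith⟩

lemma rounds_le (hn : 0 < n) (Q : Finset (Query X)) (hM : 1 / 2 ≤ logSize Q) :
    (rounds n Q : ℝ) ≤ 4 * (n * logSize Q) := by
  have hn' : (1 : ℝ) ≤ n := by exact_mod_cast hn
  have h1 : 1 / 2 ≤ n * logSize Q := by nlinarith
  have h2 := (Nat.ceil_lt_add_one (by linarith : 0 ≤ n * logSize Q)).le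
  unfold rounds
  push_cast
  exact max_le (by linarith) (by linarith)

/-- The bounds on the three parts of the equilibrium error and on the scale of the noise, in terms
of square roots. -/
lemma error_bounds {k₀ ε r m g k w L T c : ℝ} (hk₀ : 0 < k₀) (hε : 0 < ε) (hε1 : ε ≤ 1)
    (hr : 0 < r) (hm : 1 / 2 ≤ m ^ 2) (hm0 : 0 < m) (hmg : m ≤ g) (hk : k₀ ≤ k) (hL : 1 / 2 ≤ L)
    (hw1 : r * m ≤ w) (hw2 : w ≤ 2 * (r * m)) (hT : T = w ^ 2) (hc : 0 ≤ c) :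
    ε / (2 * (w * k)) ≤ 2 / k₀ ^ 2 * (g * k * L / (ε * r)) ∧
    m ^ 2 / (ε / (2 * (w * k)) * T) ≤ 4 * (g * k * L / (ε * r)) ∧
    4 * (5 * L) / w ≤ 40 / k₀ * (g * k * L / (ε * r)) ∧
    1 / r ^ 2 * (10 * w * (c * k)) / (ε / 3) * (5 * L) ≤ 300 * c * (g * k * L / (ε * r)) := by
  have hrm : 0 < r * m := mul_pos hr hm0
  have hw : 0 < w := hrm.trans_le hw1
  have hk' : 0 < k := hk₀.trans_le hk
  have hg : 0 < g := hm0.trans_le hmg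
  have hL' : 0 < L := by linarith
  have hmg' : 1 / 2 ≤ m * g := hm.trans (by nlinarith)
  refine ⟨?_, ?_, ?_, ?_⟩
  · calc ε / (2 * (w * k)) ≤ 1 / (2 * (r * m * k)) := by gcongr
      _ ≤ 2 / k₀ ^ 2 * (g * k * L / (1 * r)) := by
        rw [div_mul_div_comm, div_le_div_iff₀ (by positivity) (by positivity)]
        have h1 : k₀ ^ 2 ≤ k ^ 2 := by gcongr
        have h2 : 1 / 4 ≤ m * g * L := by nlinarith
        have h3 : k₀ ^ 2 * (1 / 4) ≤ k ^ 2 * (m * g * L) := by gcongr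
        have h4 := mul_le_mul_of_nonneg_left h3 hr.le
        linarith
      _ ≤ _ := by gcongr
  · calc m ^ 2 / (ε / (2 * (w * k)) * T) = 2 * (m ^ 2 * k) / (ε * w) := by
          rw [hT]; field_simp
      _ ≤ 2 * (m ^ 2 * k) / (ε * (r * m)) := by gcongr
      _ = 4 * (m * k * (1 / 2) / (ε * r)) := by field_simp; norm_num
      _ ≤ _ := by gcongr
  · calc 4 * (5 * L) / w ≤ 4 * (5 * L) / (r * m) := by gcongr
      _ ≤ 40 / k₀ * (g * k * L / (1 * r)) := by
        rw [div_mul_div_comm, div_le_div_iff₀ hrm (by positivity)]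
        have h3 : k₀ * (1 / 2) ≤ k * (m * g) := by gcongr
        have h4 := mul_le_mul_of_nonneg_left h3 (mul_pos hr hL').le
        linarith
      _ ≤ _ := by gcongr
  · calc 1 / r ^ 2 * (10 * w * (c * k)) / (ε / 3) * (5 * L)
        ≤ 1 / r ^ 2 * (10 * (2 * (r * m)) * (c * k)) / (ε / 3) * (5 * L) := by gcongr
      _ = 300 * c * (m * k * L / (ε * r)) := by field_simp; ring
      _ ≤ _ := by gcongr

lemma error_le {l₀ ε δ β : ℝ} (hl₀ : 0 < l₀) (hn : 0 < n) (hε : 0 < ε)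
    (hε1 : ε ≤ 1) (hδ : 0 < δ) (hl : l₀ ≤ Real.log (1 / δ)) (hβ : 0 < β) (hβ1 : β ≤ 1)
    (Q : Finset (Query X)) (hQ : 2 ≤ Q.card) :
    let U := √(Real.log (Fintype.card X + Q.card) * Real.log (1 / δ)) * Real.log (Q.card / β)
      / (ε * √n)
    let c := √(1 + 2 / l₀)
    equilibriumError n Q ε δ (β / 3) ≤ 4 * (2 / l₀ + 4 + 40 / √l₀) * U ∧
    noiseScale (ε / 3) (δ / 3) (1 / n) (density n Q) * Real.log (Q.card / (β / 3))
      ≤ 300 * c * U := by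
  intro U c
  have hn' : (0 : ℝ) < n := by exact_mod_cast hn
  have hQ' : (2 : ℝ) ≤ Q.card := by exact_mod_cast hQ
  obtain ⟨hL, hL2, hL3⟩ := log_div_third hQ' hβ hβ1
  have hM : 1 / 2 ≤ logSize Q := by
    refine le_trans ?_ (le_max_right _ _)
    exact le_trans (by linarith [Real.log_two_gt_d9]) (Real.log_le_log two_pos hQ')
  have hMN : logSize Q ≤ Real.log (Fintype.card X + Q.card) := by
    refine max_le ?_ (Real.log_le_log (by linarith)
      (by linarith [Nat.cast_nonneg (α := ℝ) (Fintype.card X)]))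
    rcases Nat.eq_zero_or_pos (Fintype.card X) with h | h
    · rw [h, Nat.cast_zero, Real.log_zero, zero_add]
      exact Real.log_nonneg (by linarith)
    · exact Real.log_le_log (by exact_mod_cast h) (by linarith)
  have hM0 : 0 ≤ logSize Q := by linarith
  have hl0 : 0 < Real.log (1 / δ) := hl₀.trans_le hl
  have hT := rounds_pos n Q
  have hw1 : √(n : ℝ) * √(logSize Q) ≤ √(rounds n Q : ℝ) := by
    rw [← Real.sqrt_mul hn'.le]
    exact Real.sqrt_le_sqrt (le_rounds n Q)
  have hw2 : √(rounds n Q : ℝ) ≤ 2 * (√(n : ℝ) * √(logSize Q)) := by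
    rw [← Real.sqrt_mul hn'.le]
    refine (Real.sqrt_le_sqrt (rounds_le hn Q hM)).trans (le_of_eq ?_)
    rw [Real.sqrt_mul (by norm_num), show (4 : ℝ) = 2 ^ 2 by norm_num, Real.sqrt_sq two_pos.le]
  -- Here `c² = 1 + 2/l₀` pays for replacing `log(3/δ)` by `log(1/δ)`.
  obtain ⟨h1, h2, h3, h4⟩ := error_bounds (k₀ := √l₀) (ε := ε) (r := √n) (m := √(logSize Q))
    (g := √(Real.log (Fintype.card X + Q.card))) (k := √(Real.log (1 / δ))) (w := √(rounds n Q))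
    (L := Real.log (Q.card / β)) (T := rounds n Q) (c := c) (Real.sqrt_pos.2 hl₀) hε hε1
    (Real.sqrt_pos.2 hn') (by rwa [Real.sq_sqrt hM0]) (Real.sqrt_pos.2 (by linarith))
    (Real.sqrt_le_sqrt hMN) (Real.sqrt_le_sqrt hl) hL hw1 hw2 (Real.sq_sqrt hT.le).symm
    (Real.sqrt_nonneg _)
  have hU : √(Real.log (Fintype.card X + Q.card)) * √(Real.log (1 / δ)) * Real.log (Q.card / β)
      / (ε * √n) = U := by
    rw [← Real.sqrt_mul (hM0.trans hMN)]
  rw [hU] at h1 h2 h3 h4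
  rw [Real.sq_sqrt hl₀.le] at h1
  rw [Real.sq_sqrt hM0] at h2
  rw [Real.sq_sqrt hn'.le] at h4
  constructor
  · have h5 : 4 * Real.log (2 / (β / 3)) / √(rounds n Q)
        ≤ 4 * (5 * Real.log (Q.card / β)) / √(rounds n Q) := by gcongr
    have h6 : learningRate n Q ε δ = ε / (2 * (√(rounds n Q) * √(Real.log (1 / δ)))) := by
      rw [learningRate, Real.sqrt_mul hT.le]
    unfold equilibriumError
    rw [h6]
    linarith
  · refine le_trans (mul_le_mul ?_ hL3 ?_ ?_) h4
    · unfold noiseScale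
      have h7 : Real.log (1 / (δ / 3)) ≤ (1 + 2 / l₀) * Real.log (1 / δ) := by
        have h8 : Real.log (1 / (δ / 3)) = Real.log 3 + Real.log (1 / δ) := by
          rw [← Real.log_mul three_ne_zero (by positivity)]
          congr 1
          field_simp
        have h9 : Real.log 3 ≤ 2 := by
          rw [Real.log_le_iff_le_exp three_pos]
          linarith [Real.add_one_le_exp 2]
        have h10 : 2 ≤ 2 / l₀ * Real.log (1 / δ) := by
          rw [div_mul_eq_mul_div, le_div_iff₀ hl₀]
          linarith
        linarith
      -- The factor 10 comes from `8 · 12 = 96 ≤ 10²`.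
      have h11 : √(8 * (density n Q : ℝ) * Real.log (1 / (δ / 3)))
          ≤ 10 * √(rounds n Q) * (c * √(Real.log (1 / δ))) := by
        have h12 : 0 ≤ 10 * √(rounds n Q : ℝ) * (c * √(Real.log (1 / δ))) := by positivity
        rw [Real.sqrt_le_left h12, mul_pow, mul_pow, mul_pow, Real.sq_sqrt hT.le,
          Real.sq_sqrt hl0.le, Real.sq_sqrt (by positivity)]
        unfold density
        push_cast
        have h13 := mul_le_mul_of_nonneg_left h7 hT.le
        have h14 : 0 ≤ rounds n Q * ((1 + 2 / l₀) * Real.log (1 / δ)) := by positivity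
        linarith
      gcongr
    · refine Real.log_nonneg ?_
      rw [le_div_iff₀ (by positivity)]
      linarith
    · have : 0 < ε / 3 := by positivity
      positivity

end ErrorBound

/-! ### The case of a single query, and the total failure probability -/

section Accuracy

variable {X : Type u} {n m : ℕ}

/-- A single query in a set closed under negation equals its own negation, so both averages are 1/2.
-/
lemma onSynthetic_of_card_one (hn : 0 < n) {Qs : Fin m → Finset (Query X)}
    (hQ : (allQueries Qs).card ≤ 1) (D : Fin n → X) {S : List X} (hS : S ≠ []) {q : Query X}
    (hq : q ∈ allQueries Qs) : onSynthetic q S = onDatabase q D := by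
  classical
  have hq' : negate q ∈ allQueries Qs := by
    obtain ⟨j, -, hj⟩ := Finset.mem_biUnion.1 hq
    exact mem_allQueries (mem_withNegations_negate hj)
  have h := Finset.card_le_one.1 hQ _ hq' _ hq
  have h1 := onDatabase_negate hn q D
  have h2 := onSynthetic_negate hS q
  rw [h] at h1 h2
  linarith

variable [Fintype X] [Nonempty X]

/-- With probability at least `1 - β` there are few bad queries and all the noise is small. -/
lemma coinLaw_good (hn : 0 < n) (Q : Finset (Query X)) (hQ : Q.Nonempty) {ε δ β : ℝ}
    (hε : 0 < ε) (hδ : 0 < δ) (hδ1 : δ < 1) (hβ : 0 < β) (hβ1 : β ≤ 1) (D : Fin n → X) :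
    ENNReal.ofReal (1 - β) ≤ coinLaw Q hQ ε δ D
      {ω | (ω.1.records.length = rounds n Q ∧
          (badQueries n Q ε δ (β / 3) D ω.1.records).card ≤ density n Q) ∧
        (∀ q, |ω.2.1 q| < Real.log (Q.card / (β / 3))) ∧
        ∀ q, |ω.2.2 q| < Real.log (Q.card / (β / 3))} := by
  have hcard : (1 : ℝ) ≤ Q.card := by exact_mod_cast Finset.card_pos.2 hQ
  set L := Real.log (Q.card / (β / 3)) with hLdef
  have hL : 0 ≤ L := Real.log_nonneg (by rw [le_div_iff₀ (by positivity)]; linarith)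
  have hlap : ENNReal.ofReal (1 - β / 3)
      ≤ (Measure.pi fun _ : Q => laplace) {z | ∀ i, |z i| < L} := by
    have h := pi_laplace_ge (ι := Q) hL
    rw [Fintype.card_coe, hLdef, ← Real.log_inv, Real.exp_log (by positivity), inv_div,
      mul_div_cancel₀ _ (by positivity)] at h
    exact h
  have hplay := play_card_badQueries_le hn Q hQ hε hδ hδ1 hβ hβ1 D
  have hset : {ω : Coins X Q | (ω.1.records.length = rounds n Q ∧
          (badQueries n Q ε δ (β / 3) D ω.1.records).card ≤ density n Q) ∧
        (∀ q, |ω.2.1 q| < L) ∧ ∀ q, |ω.2.2 q| < L}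
      = {h : Transcript X Q | h.records.length = rounds n Q ∧
          (badQueries n Q ε δ (β / 3) D h.records).card ≤ density n Q}
        ×ˢ ({z : Q → ℝ | ∀ i, |z i| < L} ×ˢ {z : Q → ℝ | ∀ i, |z i| < L}) := rfl
  rw [hset, coinLaw, Measure.prod_prod, Measure.prod_prod]
  refine le_trans ?_ (mul_le_mul' hplay (mul_le_mul' hlap hlap))
  rw [← ENNReal.ofReal_mul (by linarith), ← ENNReal.ofReal_mul (by linarith)]
  refine ENNReal.ofReal_le_ofReal ?_
  -- The three events are independent, and `(1 - β/3)³ ≥ 1 - β`.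
  nlinarith [sq_nonneg β, mul_pos hβ hβ]

end Accuracy

end OfflineMech

end

theorem mainTheorem1 (κ δ₀ : ℝ) (hκ : 0 < κ) (hδ₀ : δ₀ < 1) :
    ∃ C : ℝ, 0 < C ∧
      ∀ (X : Type u) [Fintype X] [Nonempty X] (n m : ℕ)
        (Qs : Fin m → Finset (OfflineMech.Query X))
        (hQ : (OfflineMech.allQueries Qs).Nonempty) (ε δ β : ℝ),
        0 < n → 0 < ε → ε ≤ 1 → 0 < δ → δ ≤ δ₀ → 0 < β → β ≤ 1 →
        OfflineMech.IsAccurate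
          (fun D : Fin n → X => OfflineMech.coinLaw (OfflineMech.allQueries Qs) hQ ε δ D)
          (fun D : Fin n → X => OfflineMech.mechanism κ Qs ε δ β D)
          OfflineMech.evaluate
          (fun j => OfflineMech.withNegations (Qs j))
          (C * (√(Real.log (Fintype.card X + (OfflineMech.allQueries Qs).card)
                  * Real.log (1 / δ))
                * Real.log ((OfflineMech.allQueries Qs).card / β)) / (ε * √n))
          β := by
  -- A positive lower bound for `log(1/δ)`; the maximum with 1/2 keeps it meaningful when `δ₀ ≤ 0`.
  set l₀ : ℝ := Real.log (1 / max δ₀ (1 / 2)) with hl₀def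
  have hmax : 0 < max δ₀ (1 / 2) := lt_max_of_lt_right (by norm_num)
  have hl₀ : 0 < l₀ := by
    refine Real.log_pos ?_
    rw [lt_div_iff₀ hmax, one_mul]
    exact max_lt hδ₀ (by norm_num)
  set a : ℝ := 4 * (2 / l₀ + 4 + 40 / √l₀) with ha
  set c : ℝ := 300 * √(1 + 2 / l₀) with hc
  have ha0 : 0 < a := by positivity
  have hc0 : 0 < c := by positivity
  -- `a` covers the equilibrium error, `2κc` the slack of sparse vector, and `c` the noise of the
  -- Laplace mechanism.
  refine ⟨a + (2 * κ + 1) * c, by positivity, ?_⟩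
  intro X _ _ n m Qs hQ ε δ β hn hε hε1 hδ hδδ₀ hβ hβ1 D
  have hδ1 : δ < 1 := hδδ₀.trans_lt hδ₀
  have hl : l₀ ≤ Real.log (1 / δ) := by
    refine Real.log_le_log (by positivity) ?_
    exact one_div_le_one_div_of_le hδ (hδδ₀.trans (le_max_left _ _))
  refine (OfflineMech.coinLaw_good hn _ hQ hε hδ hδ1 hβ hβ1 D).trans (measure_mono ?_)
  rintro ω ⟨⟨hlen, hbad⟩, hz, hw⟩ j q hq
  have hne : ω.1.records ≠ [] := by
    intro h
    rw [h, List.length_nil] at hlen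
    have := OfflineMech.rounds_pos n (OfflineMech.allQueries Qs)
    rw [← hlen] at this
    simp at this
  have hcard : 1 ≤ (OfflineMech.allQueries Qs).card := Finset.card_pos.2 hQ
  have hcases := OfflineMech.evaluate_error hκ hn hε hδ hδ1 Qs D rfl ω hlen hbad hz hw j hq
  rw [mul_div_assoc]
  set U : ℝ := √(Real.log (Fintype.card X + (OfflineMech.allQueries Qs).card)
    * Real.log (1 / δ)) * Real.log ((OfflineMech.allQueries Qs).card / β) / (ε * √n) with hU
  have hU0 : 0 ≤ U := by
    have : 0 ≤ Real.log ((OfflineMech.allQueries Qs).card / β) := by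
      refine Real.log_nonneg ?_
      rw [le_div_iff₀ hβ]
      have : (1 : ℝ) ≤ (OfflineMech.allQueries Qs).card := by exact_mod_cast hcard
      linarith
    positivity
  -- With one query and `β = 1` the claimed error is 0, so the answer has to be exact.
  rcases hcard.eq_or_lt with h1 | h2
  · have hexact : ∀ q' ∈ OfflineMech.allQueries Qs,
        OfflineMech.onSynthetic q' ω.1.records = OfflineMech.onDatabase q' D := fun q' hq' =>
      OfflineMech.onSynthetic_of_card_one hn h1.ge D hne hq'
    rcases hcases with ⟨he, -⟩ | ⟨⟨q', hq', hlt⟩, -⟩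
    · rw [he, hexact q (OfflineMech.mem_allQueries hq), sub_self, abs_zero]
      positivity
    · rw [hexact q' hq', sub_self] at hlt
      have := OfflineMech.learningRate_le_equilibriumError n (OfflineMech.allQueries Qs)
        (β' := β / 3) hε hδ hδ1 (by positivity) (by linarith)
      linarith [OfflineMech.learningRate_pos n (OfflineMech.allQueries Qs) hε hδ hδ1]
  · obtain ⟨hE, hN⟩ := OfflineMech.error_le hl₀ hn hε hε1 hδ hl hβ hβ1
      (OfflineMech.allQueries Qs) h2
    have hcU : 0 ≤ c * U := by positivity
    have haU : 0 ≤ a * U := by positivity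
    have hκN := mul_le_mul_of_nonneg_left hN hκ.le
    have hκU := mul_nonneg hκ.le hcU
    rcases hcases with ⟨he, hle⟩ | ⟨-, hle⟩
    · rw [he]
      refine hle.trans ?_
      rw [OfflineMech.svScale, mul_assoc κ]
      linarith
    · refine hle.trans (hN.trans ?_)
      linarith
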